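/- **Definitions.** A ReLU network $\Phi$ with $n_0$-dimensional input and $n_L$-dimensional output is a finite sequence $((W_1,b_1),\dots,(W_L,b_L))$, $L\ge 1$, with $W_i\in\mathbb{R}^{n_i\times n_{i-1}}$, $b_i\in\mathbb{R}^{n_i}$. Its realization is $R(\Phi)(x)=x_L$, where $x_0=x$, $x_i=\max\{0,W_ix_{i-1}+b_i\}$ (componentwise) for $1\le i<L$, and $x_L=W_Lx_{L-1}+b_L$. We write $L(\Phi)=L$ for the number of layers and $M(\Phi)=\sum_{i=1}^{L}(\|W_i\|_0+\|b_i\|_0)$ for the number of nonzero parameters. For $v\in\mathbb{R}^{nk}$, $\mathrm{matr}(v)\in\mathbb{R}^{n\times k}$ is the matrix whose columns, stacked one below the other, give $v$. $\|\cdot\|_2$ is the spectral norm. **Setting.** Let $p,N,N_I,n$ be natural numbers with $N,n\ge 1$ and $N_I\le N$, let $\mathcal D\subset\mathbb{R}^p$, let $\mu\mapsto L(\mu)\in\mathbb{R}^{N_I\times N}$ be a matrix-valued map on $\mathbb{R}^p$ (the stiffness matrix; only its values on $\mathcal D$ matter), and let $V\in\mathbb{R}^{N\times n}$ (the reduced basis,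 $n=n_{\mathrm{POD}}$; any matrix is allowed). Put $$B_\mu=\begin{bmatrix} L(\mu)\\ \begin{array}{c|c}\mathbf 0& I_{N-N_I}\end{array}\end{bmatrix}V\in\mathbb{R}^{N\times n}.$$ Let $0<\beta<\alpha$ and suppose: 1. for all $\mu\in\mathcal D$, the spectrum of $B_\mu^TB_\mu$ is contained in $[\beta^2,\alpha^2]$; 2. for every $\eta>0$ there is a ReLU network $\Phi^B_{V,\eta}$ with $p$-dimensional input and $Nn$-dimensional output such that $\sup_{\mu\in\mathcal D}\|B_\mu-\mathrm{matr}(R(\Phi^B_{V,\eta})(\mu))\|_2\le\eta$. Fix any such choice and set $L(B;V,\eta)=L(\Phi^B_{V,\eta})$, $M(B;V,\eta)=M(\Phi^B_{V,\eta})$. **Proposition.** There are constants $C_L,C_M>0$ depending only on $\alpha$ and $\beta$ such that, in every such setting and for every $\varepsilon\in(0,1/4)$, there is a ReLU network $\Phi$ with $p$-dimensional input and $n^2$-dimensional output satisfying all of the following: 1. $\displaystyle\sup_{\mu\in\mathcal D}\bigl\|(B_\mu^TB_\mu)^{-1}-\mathrm{matr}(R(\Phi)(\mu))\bigr\|_2\le\varepsilon$;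 2. $L(\Phi)\le C_L\,\log_2(\log_2(1/\varepsilon))\,(\log_2(1/\varepsilon)+\log_2 n)+C_L\log_2N+L(B;V,\varepsilon_1)$; 3. $M(\Phi)\le C_M\,n^2\log_2(1/\varepsilon)\,(\log_2(\log_2(1/\varepsilon))+n)\,(\log_2(1/\varepsilon)+\log_2 n)+C_M\,N n^2(\log_2(1/\varepsilon)+\log_2N)+8M(B;V,\varepsilon_1)$, where $\displaystyle\varepsilon_1=\min\Bigl\{\frac{\varepsilon\beta^4}{24\alpha},\frac{\beta^2\sqrt\varepsilon}{4},\frac{\beta^2}{12\alpha},\frac{\beta}{3}\Bigr\}.$ -/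

import Mathlib

open scoped Matrix Matrix.Norms.L2Operator

noncomputable section

/-- A ReLU neural network with `n₀`-dimensional input and `n_L`-dimensional output: a finite nonempty
sequence `((W₁, b₁), …, (W_L, b_L))` of weight matrices `Wᵢ ∈ ℝ^{nᵢ × nᵢ₋₁}` and bias vectors
`bᵢ ∈ ℝ^{nᵢ}`.  `output W b` is a sequence of length one, `hidden W b Φ` puts the layer `(W, b)`
in front of the network `Φ`.  Hidden layers have positive width. -/
inductive ReLUNetwork : ℕ → ℕ → Type
  | output {m n : ℕ} (W : Matrix (Fin n) (Fin m) ℝ) (b : Fin n → ℝ) : ReLUNetwork m n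
  | hidden {m k n : ℕ} (hk : 0 < k) (W : Matrix (Fin k) (Fin m) ℝ) (b : Fin k → ℝ)
      (Φ : ReLUNetwork k n) : ReLUNetwork m n

namespace ReLUNetwork

/-- The realization `R(Φ) : ℝ^{n₀} → ℝ^{n_L}`: every layer is affine, and it is followed by the
componentwise activation `x ↦ max {0, x}` in all layers but the last. -/
def realize : {m n : ℕ} → ReLUNetwork m n → (Fin m → ℝ) → (Fin n → ℝ)
  | _, _, output W b, x => W *ᵥ x + b
  | _, _, hidden _ W b Φ, x => Φ.realize (fun i => max 0 ((W *ᵥ x + b) i))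

/-- The number of layers `L(Φ)`. -/
def numLayers : {m n : ℕ} → ReLUNetwork m n → ℕ
  | _, _, output _ _ => 1
  | _, _, hidden _ _ _ Φ => 1 + Φ.numLayers

/-- The number `‖W‖₀ + ‖b‖₀` of nonzero parameters of one layer. -/
def layerParams {m n : ℕ} (W : Matrix (Fin n) (Fin m) ℝ) (b : Fin n → ℝ) : ℕ :=
  (∑ i, hammingNorm (W i)) + hammingNorm b

/-- The total number `M(Φ)` of nonzero parameters. -/
def numParams : {m n : ℕ} → ReLUNetwork m n → ℕ
  | _, _, output W b => layerParams W b
  | _, _, hidden _ W b Φ => layerParams W b + Φ.numParams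

end ReLUNetwork

/-- `matr v ∈ ℝ^{n × k}` for `v ∈ ℝ^{nk}`, the columns of the matrix being stacked in `v`:
the entry `(i, j)` (counted from zero) is the coordinate of `v` with number `i + n j`. -/
def matr {n k : ℕ} (v : Fin (k * n) → ℝ) : Matrix (Fin n) (Fin k) ℝ :=
  Matrix.of fun i j => v (finProdFinEquiv (j, i))

/-- The `N × N` matrix of the discretized boundary value problem: its first `N_I` rows (interior
nodes) are those of the stiffness matrix `L ∈ ℝ^{N_I × N}`, and its last `N - N_I` rows (boundary
nodes) are `(0 | I)`. -/
def systemMatrix {N NI : ℕ} (L : Matrix (Fin NI) (Fin N) ℝ) : Matrix (Fin N) (Fin N) ℝ :=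
  Matrix.of fun i j => if h : (i : ℕ) < NI then L ⟨i, h⟩ j else if i = j then 1 else 0

/-- The matrix `B_μ ∈ ℝ^{N × n}` of the reduced system: its columns are the system matrix at the
parameter `μ` applied to the columns of the reduced basis `V`. -/
def reducedMatrix {p N NI n : ℕ} (L : (Fin p → ℝ) → Matrix (Fin NI) (Fin N) ℝ)
    (V : Matrix (Fin N) (Fin n) ℝ) (μ : Fin p → ℝ) : Matrix (Fin N) (Fin n) ℝ :=
  systemMatrix (L μ) * V

/-- For all `μ ∈ D` the spectrum of `B_μᵀ B_μ` lies in `[β², α²]`. -/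
def SpectrumAssumption {p N n : ℕ} (α β : ℝ) (D : Set (Fin p → ℝ))
    (B : (Fin p → ℝ) → Matrix (Fin N) (Fin n) ℝ) : Prop :=
  ∀ μ ∈ D, spectrum ℝ ((B μ)ᵀ * B μ) ⊆ Set.Icc (β ^ 2) (α ^ 2)

/-- For every `ε > 0` the network `Φ ε` approximates `μ ↦ A_μ` on `D` up to `ε` in the
spectral norm. -/
def ReLUApproximates {p N n : ℕ} (D : Set (Fin p → ℝ))
    (A : (Fin p → ℝ) → Matrix (Fin N) (Fin n) ℝ) (Φ : ℝ → ReLUNetwork p (n * N)) : Prop :=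
  ∀ ε : ℝ, 0 < ε → ∀ μ ∈ D, ‖A μ - matr ((Φ ε).realize μ)‖ ≤ ε

/-- The accuracy at which the size of the networks for `μ ↦ B_μ` enters. -/
def innerAccuracy (α β ε : ℝ) : ℝ :=
  min (min (ε * β ^ 4 / (24 * α)) (β ^ 2 * √ε / 4)) (min (β ^ 2 / (12 * α)) (β / 3))

end

/-!
Since `x * y` is a combination of the squares of `x + y` and `x - y`, and squares are limits of
sums of iterated sawtooth functions (Yarotsky), a network with `d` hidden layers multiplies bounded
numbers up to an error of order `4 ^ (-d)`; this yields the Gram matrix and, one parallel product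
per entry, each multiplication of matrices. The Gram matrix `A` is inverted by the Newton–Schulz
iteration `X ↦ X * (2 - A * X)`, started at a multiple of the identity: one step squares the
residual `1 - A * X`, which starts with norm less than `1`, so that `log (log (1 / ε))` steps
suffice. With approximate products the residual decreases in the same way until it reaches the
noise level, and it stays there.
-/

section Hamming

variable {κ κ' R : Type*} [Fintype κ]

theorem hammingNorm_eq_sum [Zero R] [DecidableEq R] (w : κ → R) :
    hammingNorm w = ∑ i, if w i ≠ 0 then 1 else 0 :=
  Finset.card_filter _ _

theorem hammingNorm_comp_equiv [Fintype κ'] [Zero R] [DecidableEq R] (w : κ → R) (e : κ' ≃ κ) :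
    hammingNorm (w ∘ e) = hammingNorm w := by
  simp only [hammingNorm_eq_sum, Function.comp_apply]
  exact e.sum_comp fun i => if w i ≠ 0 then 1 else 0

theorem hammingNorm_option [Zero R] [DecidableEq R] (w : Option κ → R) :
    hammingNorm w = (if w none ≠ 0 then 1 else 0) + hammingNorm (w ∘ some) := by
  simp only [hammingNorm_eq_sum, Fintype.sum_option, Function.comp_apply]

theorem hammingNorm_add_le [AddGroup R] [DecidableEq R] (w w' : κ → R) :
    hammingNorm (w + w') ≤ hammingNorm w + hammingNorm w' := by
  have h := hammingDist_triangle 0 w (w + w')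
  rwa [hammingDist_zero_left, hammingDist_eq_hammingNorm w, neg_add_cancel_left] at h

theorem hammingNorm_single_le [Zero R] [DecidableEq R] [DecidableEq κ] (i : κ) (a : R) :
    hammingNorm (Pi.single i a : κ → R) ≤ 1 := by
  rw [hammingNorm_eq_sum, Fintype.sum_eq_single i fun j hj => by simp [hj]]
  split_ifs <;> simp

end Hamming

/-- `g` is an affine combination of the coordinates of `F` with at most `c` nonzero coefficients.
The coefficient vector is indexed by `Option κ`, its entry at `none` being the constant term. -/
def SparseAffine {X κ : Type*} [Fintype κ] (F : X → κ → ℝ) (c : ℕ) (g : X → ℝ) : Prop :=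
  ∃ w : Option κ → ℝ, hammingNorm w ≤ c ∧ ∀ x, g x = w none + ∑ i, w (some i) * F x i

namespace SparseAffine

variable {X κ : Type*} [Fintype κ] {F : X → κ → ℝ} {c c' : ℕ} {g g' : X → ℝ}

theorem mono (h : SparseAffine F c g) (hc : c ≤ c') : SparseAffine F c' g :=
  let ⟨w, hw, hg⟩ := h
  ⟨w, hw.trans hc, hg⟩

theorem zero (F : X → κ → ℝ) : SparseAffine F 0 fun _ => 0 :=
  ⟨0, by simp, by simp⟩

theorem const (F : X → κ → ℝ) (a : ℝ) : SparseAffine F 1 fun _ => a := by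
  classical
  exact ⟨Pi.single none a, hammingNorm_single_le none a, by simp⟩

theorem coord (F : X → κ → ℝ) (i : κ) : SparseAffine F 1 fun x => F x i := by
  classical
  exact ⟨Pi.single (some i) 1, hammingNorm_single_le _ _, by simp [Pi.single_apply]⟩

theorem add (h : SparseAffine F c g) (h' : SparseAffine F c' g') :
    SparseAffine F (c + c') fun x => g x + g' x := by
  obtain ⟨w, hw, hg⟩ := h
  obtain ⟨w', hw', hg'⟩ := h'
  refine ⟨w + w', (hammingNorm_add_le w w').trans (add_le_add hw hw'), fun x => ?_⟩
  simp only [hg, hg', Pi.add_apply, add_mul, Finset.sum_add_distrib]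
  ring

theorem const_mul (h : SparseAffine F c g) (a : ℝ) : SparseAffine F c fun x => a * g x := by
  obtain ⟨w, hw, hg⟩ := h
  refine ⟨a • w, hammingNorm_smul_le_hammingNorm.trans hw, fun x => ?_⟩
  simp only [hg, mul_add, Finset.mul_sum, Pi.smul_apply, smul_eq_mul, mul_assoc]

theorem neg (h : SparseAffine F c g) : SparseAffine F c fun x => -g x := by
  simpa using h.const_mul (-1)

theorem sub (h : SparseAffine F c g) (h' : SparseAffine F c' g') :
    SparseAffine F (c + c') fun x => g x - g' x := by
  simpa [sub_eq_add_neg] using h.add h'.neg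

theorem sum {ι : Type*} (s : Finset ι) {g : ι → X → ℝ} (h : ∀ i ∈ s, SparseAffine F c (g i)) :
    SparseAffine F (s.card * c) fun x => ∑ i ∈ s, g i x := by
  classical
  induction s using Finset.induction_on with
  | empty => simpa using zero F
  | insert a s ha ih =>
    simp only [Finset.sum_insert ha, Finset.card_insert_of_notMem ha]
    have hadd := (h a (Finset.mem_insert_self a s)).add
      (ih fun i hi => h i (Finset.mem_insert_of_mem hi))
    exact hadd.mono (by ring_nf; rfl)

end SparseAffine

namespace ReLUNetwork

theorem layerParams_eq_sum {m k : ℕ} (W : Matrix (Fin k) (Fin m) ℝ) (b : Fin k → ℝ) :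
    layerParams W b = ∑ i, ((if b i ≠ 0 then 1 else 0) + hammingNorm (W i)) := by
  rw [layerParams, hammingNorm_eq_sum b, Finset.sum_add_distrib, add_comm]

theorem exists_affine_layer {X κ κ' : Type*} [Fintype κ] {F : X → κ → ℝ} {g : X → κ' → ℝ}
    {c : κ' → ℕ} (hg : ∀ i, SparseAffine F (c i) fun x => g x i) {m k : ℕ} (e : Fin m ≃ κ)
    (e' : Fin k ≃ κ') :
    ∃ (W : Matrix (Fin k) (Fin m) ℝ) (b : Fin k → ℝ), layerParams W b ≤ ∑ i, c (e' i) ∧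
      ∀ x, W *ᵥ (F x ∘ e) + b = g x ∘ e' := by
  choose w hw hgw using hg
  refine ⟨Matrix.of fun i j => w (e' i) (some (e j)), fun i => w (e' i) none, ?_, fun x => ?_⟩
  · rw [layerParams_eq_sum]
    refine Finset.sum_le_sum fun i _ => le_trans (le_of_eq ?_) (hw (e' i))
    rw [hammingNorm_option, ← hammingNorm_comp_equiv (w (e' i) ∘ some) e]
    rfl
  · ext i
    refine (add_comm _ _).trans (.trans ?_ (hgw (e' i) x).symm)
    congr 1
    exact e.sum_comp fun j => w (e' i) (some j) * F x j

theorem sparseAffine_mulVec_add {m k : ℕ} (W : Matrix (Fin k) (Fin m) ℝ) (b : Fin k → ℝ)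
    (i : Fin k) :
    SparseAffine (fun x : Fin m → ℝ => x) ((if b i ≠ 0 then 1 else 0) + hammingNorm (W i))
      fun x => (W *ᵥ x + b) i :=
  ⟨fun j => j.elim (b i) (W i), (hammingNorm_option _).le, fun _ => add_comm _ _⟩

/-- The values `F` are the activations after `ℓ` hidden layers with at most `M` nonzero parameters
in total, for inputs in `D`. They enter through the networks which can be put on top of them, so
that hidden layers may be indexed by arbitrary finite types. -/
def HiddenComputable {p : ℕ} {D : Set (Fin p → ℝ)} {κ : Type*} [Fintype κ] (F : D → κ → ℝ)
    (ℓ M : ℕ) : Prop :=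
  ∀ (r : ℕ) (Ψ : ReLUNetwork (Fintype.card κ) r), ∃ Φ : ReLUNetwork p r,
    Φ.numLayers = ℓ + Ψ.numLayers ∧ Φ.numParams ≤ M + Ψ.numParams ∧
    ∀ x : D, Φ.realize x = Ψ.realize (F x ∘ (Fintype.equivFin κ).symm)

/-- The positive and negative parts of the coordinates of `y`, indexed by `true` and `false`. They
carry `y` through hidden layers. -/
def signParts {X ι : Type*} (y : X → ι → ℝ) (x : X) (i : ι × Bool) : ℝ :=
  max 0 (if i.2 then y x i.1 else -y x i.1)

theorem signParts_nonneg {X ι : Type*} (y : X → ι → ℝ) (x : X) (i : ι × Bool) :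
    0 ≤ signParts y x i :=
  le_max_left _ _

theorem signParts_true_sub_false {X ι : Type*} (y : X → ι → ℝ) (x : X) (i : ι) :
    signParts y x (i, true) - signParts y x (i, false) = y x i := by
  simp only [signParts, if_true, Bool.false_eq_true, if_false]
  rw [max_comm, max_comm 0 (-y x i), max_zero_sub_eq_self]

theorem sparseAffine_signParts {X ι : Type*} [Fintype ι] (y : X → ι → ℝ) (i : ι) :
    SparseAffine (signParts y) 2 fun x => y x i := by
  simpa only [signParts_true_sub_false] using
    (SparseAffine.coord (signParts y) (i, true)).sub (SparseAffine.coord (signParts y) (i, false))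

theorem sparseAffine_signed {X κ ι : Type*} [Fintype κ] {F : X → κ → ℝ} {y : X → ι → ℝ}
    {c : ι → ℕ} (hy : ∀ i, SparseAffine F (c i) fun x => y x i) (i : ι × Bool) :
    SparseAffine F (c i.1) fun x => if i.2 then y x i.1 else -y x i.1 := by
  obtain ⟨i, _ | _⟩ := i
  · simpa using (hy i).neg
  · simpa using hy i

theorem exists_append_signParts {m n r : ℕ} (hn : 0 < n) (Φ : ReLUNetwork m n)
    (Ψ : ReLUNetwork (Fintype.card (Fin n × Bool)) r) :
    ∃ Φ' : ReLUNetwork m r, Φ'.numLayers = Φ.numLayers + Ψ.numLayers ∧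
      Φ'.numParams ≤ 2 * Φ.numParams + Ψ.numParams ∧
      ∀ x, Φ'.realize x =
        Ψ.realize (signParts Φ.realize x ∘ (Fintype.equivFin (Fin n × Bool)).symm) := by
  induction Φ with
  | @output m n W b =>
    have : Nonempty (Fin n × Bool) := ⟨⟨0, hn⟩, true⟩
    let e := (Fintype.equivFin (Fin n × Bool)).symm
    obtain ⟨W', b', hparams, hrealize⟩ := exists_affine_layer
      (sparseAffine_signed (sparseAffine_mulVec_add W b)) (Equiv.refl _) e
    refine ⟨hidden Fintype.card_pos W' b' Ψ, rfl, ?_, fun x => ?_⟩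
    · refine Nat.add_le_add_right (hparams.trans_eq ?_) _
      rw [e.sum_comp fun i => (if b i.1 ≠ 0 then 1 else 0) + hammingNorm (W i.1),
        Fintype.sum_prod_type_right, Fintype.sum_bool, ← two_mul, numParams, layerParams_eq_sum]
    · exact congrArg Ψ.realize (funext fun i => congrArg (max 0) (congrFun (hrealize x) i))
  | hidden hk W b Φ ih =>
    obtain ⟨Φ', hlayers, hparams, hrealize⟩ := ih hn Ψ
    refine ⟨hidden hk W b Φ', ?_, ?_, fun x => hrealize _⟩
    · simp only [numLayers, hlayers, add_assoc]
    · simp only [numParams]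
      omega

section HiddenComputable

variable {p : ℕ} {D : Set (Fin p → ℝ)} {κ κ' : Type*} [Fintype κ] {F : D → κ → ℝ} {ℓ M M' c : ℕ}

namespace HiddenComputable

theorem mono (h : HiddenComputable F ℓ M) (hM : M ≤ M') : HiddenComputable F ℓ M' := fun r Ψ =>
  let ⟨Φ, hlayers, hparams, hrealize⟩ := h r Ψ
  ⟨Φ, hlayers, hparams.trans (Nat.add_le_add_right hM _), hrealize⟩

theorem of_network {n : ℕ} (hn : 0 < n) (Φ : ReLUNetwork p n) :
    HiddenComputable (signParts fun x : D => Φ.realize x) Φ.numLayers (2 * Φ.numParams) :=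
  fun _ Ψ =>
    let ⟨Φ', hlayers, hparams, hrealize⟩ := exists_append_signParts hn Φ Ψ
    ⟨Φ', hlayers, hparams, fun x => hrealize x⟩

theorem layer [Fintype κ'] [Nonempty κ'] (h : HiddenComputable F ℓ M) {g : D → κ' → ℝ}
    (hg : ∀ k, SparseAffine F c fun x => g x k) :
    HiddenComputable (fun x k => max 0 (g x k)) (ℓ + 1) (M + c * Fintype.card κ') := by
  intro r Ψ
  obtain ⟨W, b, hWb, hW⟩ := exists_affine_layer hg (Fintype.equivFin κ).symm
    (Fintype.equivFin κ').symm
  obtain ⟨Φ, hlayers, hparams, hrealize⟩ := h r (hidden Fintype.card_pos W b Ψ)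
  refine ⟨Φ, by rw [hlayers, numLayers, add_assoc], ?_, fun x => ?_⟩
  · simp only [Finset.sum_const, Finset.card_univ, Fintype.card_fin, smul_eq_mul] at hWb
    rw [numParams] at hparams
    linarith
  · rw [hrealize, realize, hW]
    rfl

theorem output (h : HiddenComputable F ℓ M) {r : ℕ} {g : D → Fin r → ℝ}
    (hg : ∀ k, SparseAffine F c fun x => g x k) :
    ∃ Φ : ReLUNetwork p r, Φ.numLayers = ℓ + 1 ∧ Φ.numParams ≤ M + c * r ∧
      ∀ x : D, Φ.realize x = g x := by
  obtain ⟨W, b, hWb, hW⟩ := exists_affine_layer hg (Fintype.equivFin κ).symm (Equiv.refl _)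
  obtain ⟨Φ, hlayers, hparams, hrealize⟩ := h r (ReLUNetwork.output W b)
  refine ⟨Φ, by rw [hlayers, numLayers], ?_, fun x => ?_⟩
  · simp only [Finset.sum_const, Finset.card_univ, Fintype.card_fin, smul_eq_mul] at hWb
    rw [numParams] at hparams
    linarith
  · rw [hrealize, realize, hW]
    rfl

theorem signLayer {ι : Type*} [Fintype ι] [Nonempty ι] (h : HiddenComputable F ℓ M)
    {y : D → ι → ℝ} (hy : ∀ i, SparseAffine F c fun x => y x i) :
    HiddenComputable (signParts y) (ℓ + 1) (M + c * (Fintype.card ι * 2)) := by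
  rw [← Fintype.card_bool, ← Fintype.card_prod]
  exact h.layer (sparseAffine_signed hy)

end HiddenComputable

end HiddenComputable

section SquareApproximation

/-- The hat function, which on `[0, 1]` is `t ↦ min (2 t) (2 - 2 t)`, written as a combination of
two ReLU activations. -/
noncomputable def tooth (t : ℝ) : ℝ := 2 * max 0 t - 4 * max 0 (t - 1 / 2)

/-- The `m`-th iterate of the hat function; on `[0, 1]` it has `2 ^ (m - 1)` teeth. -/
noncomputable def sawtooth (m : ℕ) : ℝ → ℝ := tooth^[m]

/-- Yarotsky's approximation of `t ↦ t ^ 2` on `[0, 1]`: the piecewise linear interpolation at the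
multiples of `2⁻ᵐ`. -/
noncomputable def sqApprox (m : ℕ) (t : ℝ) : ℝ :=
  t - ∑ s ∈ Finset.range m, sawtooth (s + 1) t / 4 ^ (s + 1)

variable {t : ℝ}

theorem tooth_mem_Icc (ht : t ∈ Set.Icc (0 : ℝ) 1) : tooth t ∈ Set.Icc (0 : ℝ) 1 := by
  obtain ⟨h₀, h₁⟩ := ht
  rw [tooth, max_eq_right h₀]
  rcases max_cases 0 (t - 1 / 2) with h | h <;> constructor <;> linarith

theorem mul_one_sub_eq_tooth (ht : t ∈ Set.Icc (0 : ℝ) 1) :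
    t * (1 - t) = tooth t / 4 + tooth t * (1 - tooth t) / 4 := by
  rw [tooth, max_eq_right ht.1]
  rcases max_choice 0 (t - 1 / 2) with h | h <;> rw [h] <;> ring

theorem sawtooth_succ (m : ℕ) (t : ℝ) : sawtooth (m + 1) t = tooth (sawtooth m t) :=
  Function.iterate_succ_apply' _ _ _

theorem sawtooth_mem_Icc (m : ℕ) (ht : t ∈ Set.Icc (0 : ℝ) 1) :
    sawtooth m t ∈ Set.Icc (0 : ℝ) 1 :=
  Set.MapsTo.iterate (fun _ => tooth_mem_Icc) m ht

theorem sqApprox_zero (t : ℝ) : sqApprox 0 t = t := by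
  simp [sqApprox]

theorem sqApprox_succ (m : ℕ) (t : ℝ) :
    sqApprox (m + 1) t = sqApprox m t - 1 / 4 ^ (m + 1) * tooth (sawtooth m t) := by
  rw [sqApprox, Finset.sum_range_succ, sawtooth_succ, sqApprox]
  ring

theorem sqApprox_sub_sq (m : ℕ) (ht : t ∈ Set.Icc (0 : ℝ) 1) :
    sqApprox m t - t ^ 2 = sawtooth m t * (1 - sawtooth m t) / 4 ^ m := by
  induction m with
  | zero =>
    rw [sqApprox_zero, sawtooth, Function.iterate_zero, id]
    ring
  | succ m ih =>
    rw [mul_one_sub_eq_tooth (sawtooth_mem_Icc m ht)] at ih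
    rw [sqApprox_succ, sawtooth_succ, sub_right_comm, ih, pow_succ]
    ring

theorem sqApprox_sub_sq_mem_Icc (m : ℕ) (ht : t ∈ Set.Icc (0 : ℝ) 1) :
    sqApprox m t - t ^ 2 ∈ Set.Icc (0 : ℝ) (1 / 4 / 4 ^ m) := by
  rw [sqApprox_sub_sq m ht]
  obtain ⟨h₀, h₁⟩ := sawtooth_mem_Icc m ht
  refine ⟨div_nonneg (mul_nonneg h₀ (sub_nonneg.2 h₁)) (by positivity), ?_⟩
  gcongr
  nlinarith [sq_nonneg (sawtooth m t - 1 / 2)]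

theorem sqApprox_nonneg (m : ℕ) (ht : t ∈ Set.Icc (0 : ℝ) 1) : 0 ≤ sqApprox m t :=
  (sq_nonneg t).trans (sub_nonneg.1 (sqApprox_sub_sq_mem_Icc m ht).1)

end SquareApproximation

section ProductApproximation

/-- The arguments `1 / 2 + (a ± b) / (4 Z)` of the two squares from which the product `a * b` is
assembled; they lie in `[0, 1]` if `|a|, |b| ≤ Z`. -/
noncomputable def productArg (Z a b : ℝ) (s : Bool) : ℝ :=
  1 / 2 + 1 / (4 * Z) * (a + (if s then 1 else -1) * b)

/-- The approximation of the product `a * b` for `|a|, |b| ≤ Z` assembled from two squares. The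
linear term is there because the arguments of the squares are shifted by `1 / 2`. -/
noncomputable def mulApprox (Z : ℝ) (m : ℕ) (a b : ℝ) : ℝ :=
  4 * Z ^ 2 * (sqApprox m (productArg Z a b true) - sqApprox m (productArg Z a b false)) - 2 * Z * b

variable {Z a b : ℝ}

theorem productArg_mem_Icc (hZ : 0 < Z) (ha : |a| ≤ Z) (hb : |b| ≤ Z) (s : Bool) :
    productArg Z a b s ∈ Set.Icc (0 : ℝ) 1 := by
  have hab : |a + (if s then 1 else -1) * b| ≤ 2 * Z := by
    refine (abs_add_le _ _).trans ?_
    rw [abs_mul, show |if s then (1 : ℝ) else -1| = 1 by cases s <;> simp]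
    linarith
  have hhalf : |1 / (4 * Z) * (a + (if s then 1 else -1) * b)| ≤ 1 / 2 := by
    rw [abs_mul, abs_of_pos (by positivity)]
    calc _ ≤ 1 / (4 * Z) * (2 * Z) := by gcongr
      _ = 1 / 2 := by field_simp; norm_num
  rw [abs_le] at hhalf
  constructor <;> rw [productArg] <;> linarith

theorem mul_eq_sq_sub_sq_productArg (hZ : 0 < Z) (a b : ℝ) :
    a * b = 4 * Z ^ 2 * (productArg Z a b true ^ 2 - productArg Z a b false ^ 2) - 2 * Z * b := by
  simp only [productArg, if_true, Bool.false_eq_true, if_false]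
  field_simp
  ring

theorem abs_mulApprox_sub_mul_le (hZ : 0 < Z) (ha : |a| ≤ Z) (hb : |b| ≤ Z) (m : ℕ) :
    |mulApprox Z m a b - a * b| ≤ Z ^ 2 / 4 ^ m := by
  obtain ⟨hpos, hpos'⟩ := sqApprox_sub_sq_mem_Icc m (productArg_mem_Icc hZ ha hb true)
  obtain ⟨hneg, hneg'⟩ := sqApprox_sub_sq_mem_Icc m (productArg_mem_Icc hZ ha hb false)
  have hdiff : mulApprox Z m a b - a * b =
      4 * Z ^ 2 * ((sqApprox m (productArg Z a b true) - productArg Z a b true ^ 2) -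
        (sqApprox m (productArg Z a b false) - productArg Z a b false ^ 2)) := by
    rw [mul_eq_sq_sub_sq_productArg hZ a b, mulApprox]
    ring
  rw [hdiff, abs_mul, abs_of_pos (by positivity)]
  calc _ ≤ 4 * Z ^ 2 * (1 / 4 / 4 ^ m) := by
        gcongr
        exact abs_le.2 ⟨by linarith, by linarith⟩
    _ = Z ^ 2 / 4 ^ m := by ring

end ProductApproximation

section ProductNetworks

variable {p : ℕ} {D : Set (Fin p → ℝ)} {τ κ ι : Type*}

/-- The activations of a network computing `sqApprox m` of the coordinates of `u` while keeping the
nonnegative values `F`: three neurons per coordinate of `u` hold the two activations of the next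
hat function and the current approximation of the square. -/
noncomputable def squareState (u : D → τ → ℝ) (F : D → κ → ℝ) (m : ℕ) (x : D) :
    (τ × Fin 3) ⊕ κ → ℝ :=
  Sum.elim (fun i => ![max 0 (sawtooth m (u x i.1)), max 0 (sawtooth m (u x i.1) - 1 / 2),
    sqApprox m (u x i.1)] i.2) (F x)

variable [Fintype τ] [Fintype κ] {F : D → κ → ℝ} {u : D → τ → ℝ} {ℓ M c m : ℕ}

theorem HiddenComputable.squareState_zero [Nonempty κ] (h : HiddenComputable F ℓ M)
    (hF : ∀ x k, 0 ≤ F x k) (hu : ∀ x i, u x i ∈ Set.Icc (0 : ℝ) 1)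
    (hs : ∀ i, SparseAffine F c fun x => u x i) :
    HiddenComputable (squareState u F 0) (ℓ + 1)
      (M + (c + 1) * (3 * Fintype.card τ + Fintype.card κ)) := by
  have hlayer := h.layer (κ' := (τ × Fin 3) ⊕ κ) (c := c + 1)
    (g := fun x => Sum.elim (fun i => ![u x i.1, u x i.1 - 1 / 2, u x i.1] i.2) (F x)) ?_
  · convert hlayer using 1
    · ext x (⟨i, j⟩ | k)
      · fin_cases j <;> simp [squareState, sawtooth, sqApprox_zero, (hu x i).1]
      · simp [squareState, hF x k]
    · simp [mul_comm 3]
  · rintro (⟨i, j⟩ | k)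
    · fin_cases j
      · exact (hs i).mono c.le_succ
      · exact (hs i).sub (SparseAffine.const F (1 / 2))
      · exact (hs i).mono c.le_succ
    · exact (SparseAffine.coord F k).mono (by omega)

theorem sparseAffine_squareState_tooth (u : D → τ → ℝ) (F : D → κ → ℝ) (m : ℕ) (i : τ) :
    SparseAffine (squareState u F m) 2 fun x => tooth (sawtooth m (u x i)) :=
  ((SparseAffine.coord (squareState u F m) (.inl (i, 0))).const_mul 2).sub
    ((SparseAffine.coord (squareState u F m) (.inl (i, 1))).const_mul 4)

theorem HiddenComputable.squareState_succ [Nonempty κ]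
    (h : HiddenComputable (squareState u F m) ℓ M) (hF : ∀ x k, 0 ≤ F x k)
    (hu : ∀ x i, u x i ∈ Set.Icc (0 : ℝ) 1) :
    HiddenComputable (squareState u F (m + 1)) (ℓ + 1)
      (M + 3 * (3 * Fintype.card τ + Fintype.card κ)) := by
  have htooth := sparseAffine_squareState_tooth u F m
  have hlayer := h.layer (κ' := (τ × Fin 3) ⊕ κ) (c := 3) (g := fun x => Sum.elim
    (fun i => ![tooth (sawtooth m (u x i.1)), tooth (sawtooth m (u x i.1)) - 1 / 2,
      sqApprox m (u x i.1) - 1 / 4 ^ (m + 1) * tooth (sawtooth m (u x i.1))] i.2) (F x)) ?_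
  · convert hlayer using 1
    · ext x (⟨i, j⟩ | k)
      · have hsq := sqApprox_nonneg (m + 1) (hu x i)
        simp only [squareState, sqApprox_succ, sawtooth_succ, Sum.elim_inl] at hsq ⊢
        fin_cases j
        · rfl
        · rfl
        · exact (max_eq_right hsq).symm
      · exact (max_eq_right (hF x k)).symm
    · simp [mul_comm 3]
  · rintro (⟨i, j⟩ | k)
    · fin_cases j
      · exact (htooth i).mono (by norm_num)
      · exact (htooth i).sub (SparseAffine.const _ (1 / 2))
      · exact (SparseAffine.coord (squareState u F m) (.inl (i, 2))).sub ((htooth i).const_mul _)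
    · exact (SparseAffine.coord (squareState u F m) (.inr k)).mono (by norm_num)

theorem HiddenComputable.squareState [Nonempty κ] (h : HiddenComputable F ℓ M)
    (hF : ∀ x k, 0 ≤ F x k) (hu : ∀ x i, u x i ∈ Set.Icc (0 : ℝ) 1) (hc : 2 ≤ c)
    (hs : ∀ i, SparseAffine F c fun x => u x i) (m : ℕ) :
    HiddenComputable (squareState u F m) (ℓ + (m + 1))
      (M + (c + 1) * (m + 1) * (3 * Fintype.card τ + Fintype.card κ)) := by
  induction m with
  | zero => simpa using h.squareState_zero hF hu hs
  | succ m ih =>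
    refine (ih.squareState_succ hF hu).mono ?_
    calc _ ≤ M + (c + 1) * (m + 1) * (3 * Fintype.card τ + Fintype.card κ) +
          (c + 1) * (3 * Fintype.card τ + Fintype.card κ) := by gcongr; omega
      _ = _ := by ring

variable [Fintype ι]

/-- The activations of a network computing `mulApprox Z m` of the pairs of coordinates of `y` given
by `a` and `b` while keeping `y`. -/
noncomputable def productState (Z : ℝ) (y : D → ι → ℝ) (a b : τ → ι) (m : ℕ) :
    D → ((τ × Bool) × Fin 3) ⊕ (ι × Bool) → ℝ :=
  squareState (fun x t => productArg Z (y x (a t.1)) (y x (b t.1)) t.2) (signParts y) m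

theorem sparseAffine_productState_coord (Z : ℝ) (y : D → ι → ℝ) (a b : τ → ι) (m : ℕ) (i : ι) :
    SparseAffine (productState Z y a b m) 2 fun x => y x i := by
  simpa only [productState, squareState, Sum.elim_inr, signParts_true_sub_false] using
    (SparseAffine.coord (productState Z y a b m) (.inr (i, true))).sub
      (SparseAffine.coord (productState Z y a b m) (.inr (i, false)))

theorem sparseAffine_productState_mulApprox (Z : ℝ) (y : D → ι → ℝ) (a b : τ → ι) (m : ℕ) (t : τ) :
    SparseAffine (productState Z y a b m) 4 fun x => mulApprox Z m (y x (a t)) (y x (b t)) :=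
  (((SparseAffine.coord (productState Z y a b m) (.inl ((t, true), 2))).sub
    (SparseAffine.coord (productState Z y a b m) (.inl ((t, false), 2)))).const_mul (4 * Z ^ 2)).sub
      ((sparseAffine_productState_coord Z y a b m (b t)).const_mul (2 * Z))

theorem HiddenComputable.productState [Nonempty ι] {y : D → ι → ℝ}
    (h : HiddenComputable (signParts y) ℓ M) {a b : τ → ι} {Z : ℝ} (hZ : 0 < Z)
    (ha : ∀ x t, |y x (a t)| ≤ Z) (hb : ∀ x t, |y x (b t)| ≤ Z) (m : ℕ) :
    HiddenComputable (productState Z y a b m) (ℓ + (m + 1))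
      (M + 6 * (m + 1) * (6 * Fintype.card τ + 2 * Fintype.card ι)) := by
  have harg : ∀ t : τ × Bool, SparseAffine (signParts y) 5
      fun x => productArg Z (y x (a t.1)) (y x (b t.1)) t.2 := fun t =>
    (SparseAffine.const _ _).add <| ((sparseAffine_signParts y (a t.1)).add
      ((sparseAffine_signParts y (b t.1)).const_mul _)).const_mul _
  have hstate := h.squareState (signParts_nonneg y)
    (fun x (t : τ × Bool) => productArg_mem_Icc hZ (ha x t.1) (hb x t.1) t.2)
    (by norm_num) harg m
  refine hstate.mono (le_of_eq ?_)
  simp only [Fintype.card_prod, Fintype.card_bool]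
  ring

end ProductNetworks

end ReLUNetwork

section MatrixNorm

variable {𝕜 m n : Type*} [RCLike 𝕜] [Fintype m] [Fintype n] [DecidableEq n]

theorem norm_apply_le_l2_opNorm (A : Matrix m n 𝕜) (i : m) (j : n) : ‖A i j‖ ≤ ‖A‖ := by
  have hcol := Matrix.l2_opNorm_mulVec A (EuclideanSpace.single j 1)
  rw [PiLp.norm_single, norm_one, mul_one] at hcol
  refine le_trans (le_of_eq ?_) ((PiLp.norm_apply_le _ i).trans hcol)
  simp

theorem l2_opNorm_le_of_norm_apply_le (A : Matrix m n 𝕜) {δ : ℝ} (hδ : 0 ≤ δ)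
    (h : ∀ i j, ‖A i j‖ ≤ δ) : ‖A‖ ≤ Fintype.card m * Fintype.card n * δ := by
  rw [Matrix.l2_opNorm_def]
  refine ContinuousLinearMap.opNorm_le_bound _ (by positivity) fun v => ?_
  have hrow (i : m) : ‖(A *ᵥ v) i‖ ≤ Fintype.card n * δ * ‖v‖ := by
    calc ‖(A *ᵥ v) i‖ ≤ ∑ j, ‖A i j * v j‖ := norm_sum_le _ _
      _ ≤ ∑ _j : n, δ * ‖v‖ := by
        gcongr with j
        rw [norm_mul]
        exact mul_le_mul (h i j) (PiLp.norm_apply_le v j) (norm_nonneg _) hδ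
      _ = Fintype.card n * δ * ‖v‖ := by simp [mul_assoc]
  have hl1 (w : EuclideanSpace 𝕜 m) : ‖w‖ ≤ ∑ i, ‖w i‖ := by
    rw [EuclideanSpace.norm_eq, Real.sqrt_le_left (by positivity)]
    exact Finset.sum_sq_le_sq_sum_of_nonneg fun _ _ => norm_nonneg _
  calc _ ≤ ∑ i, ‖(A *ᵥ v) i‖ := hl1 _
    _ ≤ ∑ _i : m, Fintype.card n * δ * ‖v‖ := by gcongr with i; exact hrow i
    _ = Fintype.card m * Fintype.card n * δ * ‖v‖ := by simp [mul_assoc]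

theorem l2_opNorm_transpose [DecidableEq m] (A : Matrix m n ℝ) : ‖Aᵀ‖ = ‖A‖ := by
  rw [← Matrix.conjTranspose_eq_transpose_of_trivial, Matrix.l2_opNorm_conjTranspose]

variable {A : Matrix n n 𝕜} {a b : ℝ}

theorem l2_opNorm_le_of_abs_spectrum_le (hA : A.IsHermitian) (hb : 0 ≤ b)
    (h : ∀ t ∈ spectrum ℝ A, |t| ≤ b) : ‖A‖ ≤ b := by
  rw [hA.spectral_theorem, Unitary.conjStarAlgAut_apply, ← Unitary.coe_star,
    CStarRing.norm_mul_coe_unitary, CStarRing.norm_coe_unitary_mul, Matrix.l2_opNorm_diagonal]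
  refine (pi_norm_le_iff_of_nonneg hb).2 fun i => ?_
  rw [Function.comp_apply, RCLike.norm_ofReal]
  exact h _ (hA.eigenvalues_mem_spectrum_real i)

theorem l2_opNorm_le_of_spectrum_subset_Icc (hA : A.IsHermitian) (ha : 0 ≤ a) (hb : 0 ≤ b)
    (h : spectrum ℝ A ⊆ Set.Icc a b) : ‖A‖ ≤ b :=
  l2_opNorm_le_of_abs_spectrum_le hA hb fun _ ht =>
    (abs_of_nonneg (ha.trans (h ht).1)).trans_le (h ht).2

theorem l2_opNorm_one_sub_smul_le_of_spectrum_subset_Icc (hA : A.IsHermitian) (ha : 0 < a)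
    (hb : 0 ≤ b) (h : spectrum ℝ A ⊆ Set.Icc a b) :
    ‖1 - (a + b)⁻¹ • A‖ ≤ 1 - a / (a + b) := by
  have hab : 0 < a + b := by positivity
  have hgap : 1 - a / (a + b) = (a + b)⁻¹ * b := by field_simp; ring
  have hH : (1 - (a + b)⁻¹ • A).IsHermitian :=
    Matrix.isHermitian_one.sub (hA.smul (IsSelfAdjoint.all _))
  rw [hgap]
  refine l2_opNorm_le_of_abs_spectrum_le hH (by positivity) fun t ht => ?_
  rw [← map_one (algebraMap ℝ (Matrix n n 𝕜)), ← spectrum.singleton_sub_eq,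
    ← Units.val_mk0 (inv_ne_zero hab.ne'), ← Units.smul_def, spectrum.unit_smul_eq_smul] at ht
  obtain ⟨_, rfl, _, ⟨t, ht, rfl⟩, rfl⟩ := ht
  obtain ⟨hat, htb⟩ := h ht
  have hfactor : 1 - (a + b)⁻¹ * t = (a + b)⁻¹ * (a + b - t) := by field_simp
  change |1 - (a + b)⁻¹ * t| ≤ (a + b)⁻¹ * b
  rw [hfactor, abs_of_nonneg (mul_nonneg (by positivity) (by linarith))]
  gcongr
  linarith

theorem isUnit_of_spectrum_subset_Ici (ha : 0 < a) (h : spectrum ℝ A ⊆ Set.Ici a) :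
    IsUnit A := by
  by_contra hu
  exact ha.not_ge (h (spectrum.zero_mem ℝ hu))

theorem l2_opNorm_inv_le_of_spectrum_subset_Ici (hA : A.IsHermitian) (ha : 0 < a)
    (h : spectrum ℝ A ⊆ Set.Ici a) : ‖A⁻¹‖ ≤ a⁻¹ := by
  obtain ⟨u, rfl⟩ := isUnit_of_spectrum_subset_Ici ha h
  refine l2_opNorm_le_of_abs_spectrum_le hA.inv (by positivity) fun t ht => ?_
  rw [← Matrix.coe_units_inv, ← spectrum.map_inv, Set.mem_inv] at ht
  have hat : a ≤ t⁻¹ := h ht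
  have ht₀ : 0 < t := inv_pos.1 (ha.trans_le hat)
  rw [abs_of_pos ht₀]
  exact (le_inv_comm₀ ha ht₀).1 hat

end MatrixNorm

section Gram

theorem card_le_card_of_isUnit_transpose_mul {R m n : Type*} [CommRing R] [Nontrivial R] [Fintype m]
    [Fintype n] [DecidableEq n] {B : Matrix m n R} (h : IsUnit (Bᵀ * B)) :
    Fintype.card n ≤ Fintype.card m := by
  rw [← Matrix.rank_of_isUnit _ h]
  exact (Matrix.rank_mul_le_right _ _).trans (Matrix.rank_le_card_height _)

variable {m n : Type*} [Fintype m]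

theorem isHermitian_gram (B : Matrix m n ℝ) : (Bᵀ * B).IsHermitian :=
  Matrix.isHermitian_conjTranspose_mul_self B

variable [Fintype n] [DecidableEq n]

theorem l2_opNorm_le_of_l2_opNorm_gram_le {B : Matrix m n ℝ} {a : ℝ} (ha : 0 ≤ a)
    (h : ‖Bᵀ * B‖ ≤ a ^ 2) : ‖B‖ ≤ a := by
  rw [← Matrix.conjTranspose_eq_transpose_of_trivial, Matrix.l2_opNorm_conjTranspose_mul_self,
    ← sq] at h
  exact le_of_sq_le_sq h ha

theorem l2_opNorm_gram_sub_gram_le (B B' : Matrix m n ℝ) :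
    ‖Bᵀ * B - B'ᵀ * B'‖ ≤ (‖B‖ + ‖B'‖) * ‖B - B'‖ := by
  classical
  have hsplit : Bᵀ * B - B'ᵀ * B' = Bᵀ * (B - B') + (B - B')ᵀ * B' := by
    rw [Matrix.transpose_sub, Matrix.mul_sub, Matrix.sub_mul]
    abel
  calc ‖Bᵀ * B - B'ᵀ * B'‖ ≤ ‖Bᵀ‖ * ‖B - B'‖ + ‖(B - B')ᵀ‖ * ‖B'‖ := by
        rw [hsplit]
        exact (norm_add_le _ _).trans
          (add_le_add (Matrix.l2_opNorm_mul _ _) (Matrix.l2_opNorm_mul _ _))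
    _ = (‖B‖ + ‖B'‖) * ‖B - B'‖ := by
        rw [l2_opNorm_transpose, l2_opNorm_transpose]
        ring

end Gram

section Newton

variable {R : Type*} [NormedRing R] {mul : R → R → R} {A X : R} {Z e ρ : ℝ}

/-- `mul` multiplies elements of norm at most `Z` up to an error of norm at most `e`. -/
def IsApproxMul (mul : R → R → R) (Z e : ℝ) : Prop :=
  ∀ B C, ‖B‖ ≤ Z → ‖C‖ ≤ Z → ‖mul B C - B * C‖ ≤ e

/-- One step `X ↦ X (2 - A X)` of the Newton–Schulz iteration for the inverse of `A`, carried out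
with the multiplication `mul`. -/
def newtonStep (mul : R → R → R) (A X : R) : R := mul X (2 - mul A X)

/-- All factors multiplied in a Newton–Schulz step from `X` have norm at most `Z`. -/
structure NewtonBounded (mul : R → R → R) (Z : ℝ) (A X : R) : Prop where
  norm_matrix_le : ‖A‖ ≤ Z
  norm_iterate_le : ‖X‖ ≤ Z
  norm_factor_le : ‖2 - mul A X‖ ≤ Z

/-- `1 - A (X (2 - A X)) = (1 - A X) ^ 2`; the errors of the two multiplications enter linearly. -/
theorem norm_one_sub_mul_newtonStep_le [NormOneClass R] (hmul : IsApproxMul mul Z e)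
    (hb : NewtonBounded mul Z A X) (hρ : ‖1 - A * X‖ ≤ ρ) (hρ₁ : ρ ≤ 1) :
    ‖1 - A * newtonStep mul A X‖ ≤ ρ ^ 2 + (2 + Z) * e := by
  have hE₁ := hmul A X hb.norm_matrix_le hb.norm_iterate_le
  have hE₂ := hmul X (2 - mul A X) hb.norm_iterate_le hb.norm_factor_le
  have hexpand : 1 - A * newtonStep mul A X = (1 - A * X) * (1 - A * X) +
      A * X * (mul A X - A * X) - A * (newtonStep mul A X - X * (2 - mul A X)) := by
    noncomm_ring
  have hAX : ‖A * X‖ ≤ 2 := by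
    calc ‖A * X‖ = ‖1 - (1 - A * X)‖ := by rw [sub_sub_cancel]
      _ ≤ ‖(1 : R)‖ + ‖1 - A * X‖ := norm_sub_le _ _
      _ ≤ 2 := by rw [norm_one]; linarith
  have hA := hb.norm_matrix_le
  have : 0 ≤ e := (norm_nonneg _).trans hE₁
  calc _ ≤ ‖1 - A * X‖ * ‖1 - A * X‖ + ‖A * X‖ * ‖mul A X - A * X‖ +
        ‖A‖ * ‖newtonStep mul A X - X * (2 - mul A X)‖ := by
        rw [hexpand]
        refine (norm_sub_le _ _).trans (add_le_add ((norm_add_le _ _).trans ?_) (norm_mul_le _ _))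
        exact add_le_add (norm_mul_le _ _) (norm_mul_le _ _)
    _ ≤ ρ * ρ + 2 * e + Z * e := by
        gcongr
        · exact (norm_nonneg _).trans hρ
        · exact (norm_nonneg _).trans hA
        · exact hE₂
    _ = ρ ^ 2 + (2 + Z) * e := by ring

theorem newtonBounded_of_norm_one_sub_mul_le [NormOneClass R] (hmul : IsApproxMul mul Z e)
    (hZ : 3 + e ≤ Z) (hA : ‖A‖ ≤ Z) (hX : ‖X‖ ≤ Z) (hρ : ‖1 - A * X‖ ≤ 1) :
    NewtonBounded mul Z A X := by
  refine ⟨hA, hX, ?_⟩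
  have hsplit : 2 - mul A X = 1 + (1 - A * X) - (mul A X - A * X) := by
    rw [← one_add_one_eq_two]
    abel
  rw [hsplit]
  have hsub := norm_sub_le (1 + (1 - A * X)) (mul A X - A * X)
  have hadd := norm_add_le (1 : R) (1 - A * X)
  rw [norm_one] at hadd
  linarith [hmul A X hA hX]

theorem norm_one_sub_mul_newtonStep_iterate_le [NormOneClass R] (hmul : IsApproxMul mul Z e)
    (hZ : 3 + e ≤ Z) (hA : ‖A‖ ≤ Z) (hbdd : ∀ X, ‖1 - A * X‖ ≤ 1 → ‖X‖ ≤ Z) {ρ : ℕ → ℝ}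
    (hρ₁ : ∀ k, ρ k ≤ 1) (hρ : ∀ k, ρ k ^ 2 + (2 + Z) * e ≤ ρ (k + 1))
    (hX : ‖1 - A * X‖ ≤ ρ 0) (k : ℕ) : ‖1 - A * (newtonStep mul A)^[k] X‖ ≤ ρ k := by
  induction k with
  | zero => exact hX
  | succ k ih =>
    rw [Function.iterate_succ_apply']
    have hle := ih.trans (hρ₁ k)
    exact (norm_one_sub_mul_newtonStep_le hmul
      (newtonBounded_of_norm_one_sub_mul_le hmul hZ hA (hbdd _ hle) hle) ih (hρ₁ k)).trans (hρ k)

variable {A' I : R} {κ : ℝ}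

theorem norm_le_of_norm_one_sub_mul_le_one [NormOneClass R] (hI : I * A = 1) (hκ : ‖I‖ ≤ κ)
    (hA' : κ * ‖A - A'‖ ≤ 1 / 4) (hX : ‖1 - A' * X‖ ≤ 1) : ‖X‖ ≤ 3 * κ := by
  have hsplit : X = I * (1 - (1 - A' * X) + (A - A') * X) := by
    have hAX : 1 - (1 - A' * X) + (A - A') * X = A * X := by noncomm_ring
    rw [hAX, ← mul_assoc, hI, one_mul]
  have hκ₀ : 0 ≤ κ := (norm_nonneg _).trans hκ
  have hbound : ‖X‖ ≤ κ * (2 + ‖A - A'‖ * ‖X‖) := by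
    calc ‖X‖ = ‖I * (1 - (1 - A' * X) + (A - A') * X)‖ := by rw [← hsplit]
      _ ≤ ‖I‖ * (‖(1 : R)‖ + ‖1 - A' * X‖ + ‖A - A'‖ * ‖X‖) := by
        refine (norm_mul_le _ _).trans ?_
        gcongr
        exact (norm_add_le _ _).trans (add_le_add (norm_sub_le _ _) (norm_mul_le _ _))
      _ ≤ κ * (2 + ‖A - A'‖ * ‖X‖) := by
        rw [norm_one]
        gcongr
        linarith
  have habsorb : κ * ‖A - A'‖ * ‖X‖ ≤ 1 / 4 * ‖X‖ := by gcongr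
  linarith

theorem norm_leftInverse_sub_le (hI : I * A = 1) :
    ‖I - X‖ ≤ ‖I‖ * (‖1 - A' * X‖ + ‖A - A'‖ * ‖X‖) := by
  have hsplit : I - X = I * (1 - A' * X - (A - A') * X) := by
    have hAX : 1 - A' * X - (A - A') * X = 1 - A * X := by noncomm_ring
    rw [hAX, mul_sub, ← mul_assoc, hI, one_mul, mul_one]
  rw [hsplit]
  refine (norm_mul_le _ _).trans ?_
  gcongr
  exact (norm_sub_le _ _).trans (add_le_add le_rfl (norm_mul_le _ _))

end Newton

section Recursion

/-- The bounds for the residuals of an inexact Newton–Schulz iteration: doubly exponential decay of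
base `p` down to the level `θ`. -/
noncomputable def residualBound (p θ : ℝ) (k : ℕ) : ℝ := max θ (p ^ (2 ^ k + 1))

variable {p θ : ℝ}

theorem residualBound_le (hp : 0 ≤ p) (hp₁ : p ≤ 1) (hθ : θ ≤ p) (k : ℕ) :
    residualBound p θ k ≤ p :=
  max_le hθ (pow_le_of_le_one hp hp₁ (Nat.succ_ne_zero _))

theorem residualBound_sq_add_le (hp : 0 < p) (hp₁ : p ≤ 1) (hθ : 0 ≤ θ) (hθp : θ ≤ p) (k : ℕ) :
    residualBound p θ k ^ 2 + (1 / p - 1) * θ ^ 2 ≤ residualBound p θ (k + 1) := by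
  have hle : θ ≤ residualBound p θ k := le_max_left _ _
  calc _ ≤ residualBound p θ k ^ 2 + (1 / p - 1) * residualBound p θ k ^ 2 := by
        gcongr
        exact sub_nonneg.2 (one_le_one_div hp hp₁)
    _ = residualBound p θ k ^ 2 / p := by ring
    _ ≤ residualBound p θ (k + 1) := by
        rw [div_le_iff₀ hp]
        rcases max_choice θ (p ^ (2 ^ k + 1)) with h | h <;> rw [residualBound, residualBound, h]
        · calc θ ^ 2 = θ * θ := sq θ
            _ ≤ max θ (p ^ (2 ^ (k + 1) + 1)) * p := by
              gcongr
              exact le_max_left _ _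
        · calc (p ^ (2 ^ k + 1)) ^ 2 = p ^ (2 ^ (k + 1) + 1) * p := by ring
            _ ≤ max θ (p ^ (2 ^ (k + 1) + 1)) * p := by
              gcongr
              exact le_max_right _ _

theorem newtonBounded_iterate_and_norm_sub_iterate_le {R : Type*} [NormedRing R] [NormOneClass R]
    {mul : R → R → R} {A A' I X : R} {Z e κ : ℝ} (hmul : IsApproxMul mul Z e) (hZ : 3 + e ≤ Z)
    (hκZ : 3 * κ ≤ Z) (hA'Z : ‖A'‖ ≤ Z) (hI : I * A = 1) (hκ : ‖I‖ ≤ κ)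
    (hA' : κ * ‖A - A'‖ ≤ 1 / 4) (hp : 0 < p) (hp₁ : p ≤ 1) (hθ : 0 ≤ θ) (hθp : θ ≤ p)
    (he : (2 + Z) * e ≤ (1 / p - 1) * θ ^ 2) (hX : ‖1 - A' * X‖ ≤ p ^ 2) (k : ℕ) :
    NewtonBounded mul Z A' ((newtonStep mul A')^[k] X) ∧
      ‖I - (newtonStep mul A')^[k] X‖ ≤ κ * (residualBound p θ k + ‖A - A'‖ * (3 * κ)) := by
  have hbdd (Y : R) (hY : ‖1 - A' * Y‖ ≤ 1) : ‖Y‖ ≤ 3 * κ :=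
    norm_le_of_norm_one_sub_mul_le_one hI hκ hA' hY
  have hρ₁ (k : ℕ) : residualBound p θ k ≤ 1 := (residualBound_le hp.le hp₁ hθp k).trans hp₁
  have hres : ‖1 - A' * (newtonStep mul A')^[k] X‖ ≤ residualBound p θ k :=
    norm_one_sub_mul_newtonStep_iterate_le hmul hZ hA'Z (fun Y hY => (hbdd Y hY).trans hκZ) hρ₁
      (fun k => (add_le_add_right he _).trans (residualBound_sq_add_le hp hp₁ hθ hθp k))
      (hX.trans (le_max_right _ _)) k
  have hiter := hbdd _ (hres.trans (hρ₁ k))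
  refine ⟨newtonBounded_of_norm_one_sub_mul_le hmul hZ hA'Z (hiter.trans hκZ)
    (hres.trans (hρ₁ k)), (norm_leftInverse_sub_le (A' := A') hI).trans ?_⟩
  gcongr
  exact (norm_nonneg _).trans hκ

end Recursion

section Logarithms

variable {ε : ℝ}

theorem two_le_logb_one_div (hε : ε ∈ Set.Ioo (0 : ℝ) (1 / 4)) : 2 ≤ Real.logb 2 (1 / ε) := by
  rw [Real.le_logb_iff_rpow_le one_lt_two (one_div_pos.2 hε.1), le_div_iff₀ hε.1]
  norm_num
  linarith [hε.2]

theorem one_le_logb_logb_one_div (hε : ε ∈ Set.Ioo (0 : ℝ) (1 / 4)) :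
    1 ≤ Real.logb 2 (Real.logb 2 (1 / ε)) := by
  have hl := two_le_logb_one_div hε
  rwa [Real.le_logb_iff_rpow_le one_lt_two (by linarith), Real.rpow_one]

theorem logb_two_natCast_nonneg (n : ℕ) : 0 ≤ Real.logb 2 n :=
  div_nonneg (Real.log_natCast_nonneg n) (Real.log_nonneg one_le_two)

theorem logb_two_le_self {x : ℝ} (hx : 1 ≤ x) : Real.logb 2 x ≤ x := by
  rw [Real.logb_le_iff_le_rpow one_lt_two (zero_lt_one.trans_le hx)]
  have hbernoulli := one_add_mul_self_le_rpow_one_add (by norm_num : (-1 : ℝ) ≤ 1) hx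
  rw [mul_one, one_add_one_eq_two] at hbernoulli
  linarith

theorem one_half_pow_le_of_logb_le {x : ℝ} (hx : 0 < x) {k : ℕ} (hk : Real.logb 2 (1 / x) ≤ k) :
    (1 / 2 : ℝ) ^ k ≤ x := by
  rw [Real.logb_le_iff_le_rpow one_lt_two (one_div_pos.2 hx), Real.rpow_natCast] at hk
  rw [one_div_pow]
  exact (one_div_le hx (by positivity)).1 hk

theorem exists_steps_residual_le {p b : ℝ} (hp : 0 ≤ p) (hp₁ : p < 1) (hb : 0 < b) :
    ∃ C : ℝ, 0 < C ∧ ∀ ε ∈ Set.Ioo (0 : ℝ) (1 / 4), ∃ K : ℕ,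
      K ≤ C * Real.logb 2 (Real.logb 2 (1 / ε)) ∧ p ^ (2 ^ K + 1) ≤ b * ε := by
  obtain ⟨i, hi⟩ := exists_pow_lt_of_lt_one (by positivity : 0 < 1 / 2 * min b 1) hp₁
  refine ⟨i + 2, by positivity, fun ε hε => ?_⟩
  have hll := one_le_logb_logb_one_div hε
  set l := Real.logb 2 (1 / ε)
  have hl : 2 ≤ l := two_le_logb_one_div hε
  refine ⟨⌈Real.logb 2 l⌉₊ + i, ?_, ?_⟩
  · have hceil := (Nat.ceil_lt_add_one (zero_le_one.trans hll)).le
    push_cast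
    nlinarith [(Nat.cast_nonneg i : (0 : ℝ) ≤ i)]
  · set J := ⌈Real.logb 2 l⌉₊
    have hJ : l ≤ (2 ^ J : ℕ) := by
      have hceil := Nat.le_ceil (Real.logb 2 l)
      rw [Real.logb_le_iff_le_rpow one_lt_two (by linarith), Real.rpow_natCast] at hceil
      exact_mod_cast hceil
    have hexp : i * 2 ^ J ≤ 2 ^ (J + i) + 1 := by
      rw [pow_add, mul_comm]
      exact (Nat.mul_le_mul_left _ Nat.lt_two_pow_self.le).trans (Nat.le_succ _)
    calc p ^ (2 ^ (J + i) + 1) ≤ (p ^ i) ^ 2 ^ J := by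
          rw [← pow_mul]
          exact pow_le_pow_of_le_one hp hp₁.le hexp
      _ ≤ (1 / 2 * min b 1) ^ 2 ^ J := by gcongr
      _ = min b 1 ^ 2 ^ J * (1 / 2) ^ 2 ^ J := by rw [mul_pow, mul_comm]
      _ ≤ b * ε := by
        gcongr
        · exact (pow_le_of_le_one (by positivity) (min_le_right _ _) (by positivity)).trans
            (min_le_left _ _)
        · exact one_half_pow_le_of_logb_le hε.1 hJ

theorem exists_depth_mul_cube_div_le {a c : ℝ} (ha : 0 < a) (hc : 0 < c) :
    ∃ C : ℝ, 0 < C ∧ ∀ ε ∈ Set.Ioo (0 : ℝ) (1 / 4), ∀ n : ℕ, 0 < n → ∃ m : ℕ,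
      (m : ℝ) + 2 ≤ C * (Real.logb 2 (1 / ε) + Real.logb 2 n) ∧
      a * (n ^ 3 / 4 ^ m) ≤ c * ε ^ 2 := by
  refine ⟨|Real.logb 2 (a / c)| + 6, by positivity, fun ε hε n hn => ?_⟩
  have hε₀ := hε.1
  have hlog : Real.logb 2 (1 / (c * ε ^ 2 / (a * n ^ 3))) =
      Real.logb 2 (a / c) + 2 * Real.logb 2 (1 / ε) + 3 * Real.logb 2 n := by
    rw [show 1 / (c * ε ^ 2 / (a * n ^ 3)) = a / c * (1 / ε) ^ 2 * n ^ 3 by field_simp,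
      Real.logb_mul (by positivity) (by positivity), Real.logb_mul (by positivity) (by positivity),
      Real.logb_pow, Real.logb_pow]
    push_cast
    rfl
  have hl := two_le_logb_one_div hε
  have hln := logb_two_natCast_nonneg n
  set l := Real.logb 2 (1 / ε)
  set ln := Real.logb 2 n
  set lc := Real.logb 2 (a / c)
  have habs : 0 ≤ |lc| := abs_nonneg lc
  refine ⟨⌈|lc| + 2 * l + 3 * ln⌉₊, ?_, ?_⟩
  · have hceil := (Nat.ceil_lt_add_one (by positivity : 0 ≤ |lc| + 2 * l + 3 * ln)).le
    nlinarith
  · set m := ⌈|lc| + 2 * l + 3 * ln⌉₊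
    have hm : Real.logb 2 (1 / (c * ε ^ 2 / (a * n ^ 3))) ≤ m := by
      rw [hlog]
      exact le_trans (by gcongr; exact le_abs_self _) (Nat.le_ceil _)
    calc a * (n ^ 3 / 4 ^ m) = a * n ^ 3 * (1 / 4) ^ m := by rw [one_div_pow]; ring
      _ ≤ a * n ^ 3 * (1 / 2) ^ m := by gcongr; norm_num
      _ ≤ a * n ^ 3 * (c * ε ^ 2 / (a * n ^ 3)) := by
        gcongr
        exact one_half_pow_le_of_logb_le (by positivity) hm
      _ = c * ε ^ 2 := by field_simp

end Logarithms

namespace ReLUNetwork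

section MatrixProducts

/-- The matrix product with all products of entries replaced by their approximations. -/
noncomputable def matMulApprox {l m n : Type*} [Fintype m] (Z : ℝ) (d : ℕ) (A : Matrix l m ℝ)
    (B : Matrix m n ℝ) : Matrix l n ℝ :=
  Matrix.of fun i j => ∑ k, mulApprox Z d (A i k) (B k j)

variable {l m n : Type*} [Fintype l] [Fintype m] [Fintype n] [DecidableEq m] [DecidableEq n]

theorem norm_matMulApprox_sub_mul_le {Z : ℝ} (hZ : 0 < Z) (d : ℕ) {A : Matrix l m ℝ}
    {B : Matrix m n ℝ} (hA : ‖A‖ ≤ Z) (hB : ‖B‖ ≤ Z) :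
    ‖matMulApprox Z d A B - A * B‖ ≤
      Fintype.card l * Fintype.card n * (Fintype.card m * (Z ^ 2 / 4 ^ d)) := by
  refine l2_opNorm_le_of_norm_apply_le _ (by positivity) fun i j => ?_
  rw [Matrix.sub_apply, matMulApprox, Matrix.of_apply, Matrix.mul_apply, ← Finset.sum_sub_distrib]
  calc _ ≤ ∑ k, |mulApprox Z d (A i k) (B k j) - A i k * B k j| := Finset.abs_sum_le_sum_abs _ _
    _ ≤ ∑ _k : m, Z ^ 2 / 4 ^ d := by
      gcongr with k
      exact abs_mulApprox_sub_mul_le hZ ((norm_apply_le_l2_opNorm A i k).trans hA)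
        ((norm_apply_le_l2_opNorm B k j).trans hB) d
    _ = Fintype.card m * (Z ^ 2 / 4 ^ d) := by simp

theorem isApproxMul_matMulApprox {Z : ℝ} (hZ : 0 < Z) (d : ℕ) :
    IsApproxMul (matMulApprox (l := n) (m := n) (n := n) Z d) Z
      (Z ^ 2 * (Fintype.card n ^ 3 / 4 ^ d)) := fun _ _ hB hC =>
  (norm_matMulApprox_sub_mul_le hZ d hB hC).trans_eq (by ring)

end MatrixProducts

section NewtonNetworks

/-- The entries of a family of matrices as one vector. -/
def matEntries {X κ ι ι' : Type*} (A : X → κ → Matrix ι ι' ℝ) (x : X) (i : κ × ι × ι') : ℝ :=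
  A x i.1 i.2.1 i.2.2

/-- The approximate inverse of the Gram matrix of `B`: the entries are multiplied with `2 ^ d₁`
pieces in `Bᵀ * B` and with `2 ^ d₂` pieces in the `K` Newton–Schulz steps, which start at the
scalar matrix `s`. -/
noncomputable def gramInverseApprox {m n : Type*} [Fintype m] [Fintype n] [DecidableEq n]
    (Z : ℝ) (d₁ d₂ : ℕ) (s : ℝ) (K : ℕ) (B : Matrix m n ℝ) : Matrix n n ℝ :=
  (newtonStep (matMulApprox Z d₂) (matMulApprox Z d₁ Bᵀ B))^[K] (s • 1)

variable {p N n d ℓ M : ℕ} {D : Set (Fin p → ℝ)} {A X C : D → Matrix (Fin n) (Fin n) ℝ} {Z : ℝ}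

theorem sparseAffine_productState_matMulApprox {l m n ι : Type*} [Fintype l] [Fintype m] [Fintype n]
    [Fintype ι] {y : D → ι → ℝ} {a b : l × m × n → ι} {A : D → Matrix l m ℝ} {B : D → Matrix m n ℝ}
    (hA : ∀ x t, y x (a t) = A x t.1 t.2.1) (hB : ∀ x t, y x (b t) = B x t.2.1 t.2.2) (i : l)
    (j : n) :
    SparseAffine (productState Z y a b d) (Fintype.card m * 4)
      fun x => matMulApprox Z d (A x) (B x) i j := by
  have hsum := SparseAffine.sum Finset.univ fun k _ =>
    sparseAffine_productState_mulApprox Z y a b d (i, k, j)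
  simpa only [hA, hB, matMulApprox, Matrix.of_apply, Finset.card_univ] using hsum

theorem HiddenComputable.newtonFactor (hn : 0 < n) (hZ : 0 < Z) (hA : ∀ x, ‖A x‖ ≤ Z)
    (hX : ∀ x, ‖X x‖ ≤ Z) (h : HiddenComputable (signParts (matEntries fun x => ![A x, X x])) ℓ M) :
    HiddenComputable
      (signParts (matEntries fun x => ![A x, X x, 2 - matMulApprox Z d (A x) (X x)]))
      (ℓ + (d + 2)) (M + 90 * (d + 1) * n ^ 3) := by
  have : Nonempty (Fin n) := ⟨⟨0, hn⟩⟩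
  have hproducts := h.productState (τ := Fin n × Fin n × Fin n) (a := fun t => (0, t.1, t.2.1))
    (b := fun t => (1, t.2.1, t.2.2)) hZ
    (fun x t => (norm_apply_le_l2_opNorm _ _ _).trans (hA x))
    (fun x t => (norm_apply_le_l2_opNorm _ _ _).trans (hX x)) d
  have hfactor : HiddenComputable
      (signParts (matEntries fun x => ![A x, X x, 2 - matMulApprox Z d (A x) (X x)])) _ _ :=
    hproducts.signLayer (c := n * 4 + 1) (by
      rintro ⟨k, i, j⟩
      fin_cases k
      · exact (sparseAffine_productState_coord _ _ _ _ _ (0, i, j)).mono (by omega)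
      · exact (sparseAffine_productState_coord _ _ _ _ _ (1, i, j)).mono (by omega)
      · refine ((SparseAffine.const _ ((2 : Matrix (Fin n) (Fin n) ℝ) i j)).sub
          (sparseAffine_productState_matMulApprox (fun _ _ => rfl) (fun _ _ => rfl) i j)).mono ?_
        rw [Fintype.card_fin]
        omega)
  refine hfactor.mono ?_
  simp only [Fintype.card_prod, Fintype.card_fin, Nat.succ_eq_add_one]
  have hsq : n * n ≤ n ^ 3 := by nlinarith [Nat.mul_le_mul_left (n * n) hn]
  nlinarith [Nat.mul_le_mul_left (d + 1) hsq, Nat.zero_le (d * n ^ 3)]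

theorem HiddenComputable.mulLast (hn : 0 < n) (hZ : 0 < Z) (hX : ∀ x, ‖X x‖ ≤ Z)
    (hC : ∀ x, ‖C x‖ ≤ Z)
    (h : HiddenComputable (signParts (matEntries fun x => ![A x, X x, C x])) ℓ M) :
    HiddenComputable (signParts (matEntries fun x => ![A x, matMulApprox Z d (X x) (C x)]))
      (ℓ + (d + 2)) (M + 90 * (d + 1) * n ^ 3) := by
  have : Nonempty (Fin n) := ⟨⟨0, hn⟩⟩
  have hproducts := h.productState (τ := Fin n × Fin n × Fin n) (a := fun t => (1, t.1, t.2.1))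
    (b := fun t => (2, t.2.1, t.2.2)) hZ
    (fun x t => (norm_apply_le_l2_opNorm _ _ _).trans (hX x))
    (fun x t => (norm_apply_le_l2_opNorm _ _ _).trans (hC x)) d
  have hproduct : HiddenComputable
      (signParts (matEntries fun x => ![A x, matMulApprox Z d (X x) (C x)])) _ _ :=
    hproducts.signLayer (c := n * 4) (by
      rintro ⟨k, i, j⟩
      fin_cases k
      · exact (sparseAffine_productState_coord _ _ _ _ _ (0, i, j)).mono (by omega)
      · refine (sparseAffine_productState_matMulApprox (fun _ _ => rfl) (fun _ _ => rfl) i j).mono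
          ?_
        rw [Fintype.card_fin])
  refine hproduct.mono ?_
  simp only [Fintype.card_prod, Fintype.card_fin, Nat.succ_eq_add_one]
  have hsq : n * n ≤ n ^ 3 := by nlinarith [Nat.mul_le_mul_left (n * n) hn]
  nlinarith [Nat.mul_le_mul_left (d + 1) hsq, Nat.zero_le (d * n ^ 3)]

theorem HiddenComputable.newtonStep_iterate (hn : 0 < n)
    (h : HiddenComputable (signParts (matEntries fun x => ![A x, X x])) ℓ M) (hZ : 0 < Z)
    (hb : ∀ x k, NewtonBounded (matMulApprox Z d) Z (A x)
      ((newtonStep (matMulApprox Z d) (A x))^[k] (X x))) (K : ℕ) :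
    HiddenComputable (signParts (matEntries fun x =>
        ![A x, (newtonStep (matMulApprox Z d) (A x))^[K] (X x)]))
      (ℓ + K * (2 * (d + 2))) (M + K * (180 * (d + 1) * n ^ 3)) := by
  induction K with
  | zero => simpa using h
  | succ K ih =>
    have hstep := (ih.newtonFactor (d := d) hn hZ (fun x => (hb x K).norm_matrix_le)
      fun x => (hb x K).norm_iterate_le).mulLast (d := d) hn hZ
        (fun x => (hb x K).norm_iterate_le) fun x => (hb x K).norm_factor_le
    simp only [Function.iterate_succ_apply']
    convert hstep using 1
    · rfl
    · ring
    · ring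

theorem hiddenComputable_gram (hN : 0 < N) (hn : 0 < n) (Ψ : ReLUNetwork p (n * N)) (hZ : 0 < Z)
    (hB : ∀ x : D, ‖matr (Ψ.realize x)‖ ≤ Z) (d : ℕ) (s : ℝ) :
    HiddenComputable (D := D) (signParts (matEntries fun x =>
        ![matMulApprox Z d (matr (Ψ.realize x))ᵀ (matr (Ψ.realize x)), s • 1]))
      (Ψ.numLayers + (d + 2)) (2 * Ψ.numParams + 64 * (d + 1) * (N * n ^ 2)) := by
  have : Nonempty (Fin n) := ⟨⟨0, hn⟩⟩
  have : Nonempty (Fin (n * N)) := ⟨⟨0, Nat.mul_pos hn hN⟩⟩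
  have hproducts := (HiddenComputable.of_network (D := D) (Nat.mul_pos hn hN) Ψ).productState
    (τ := Fin n × Fin N × Fin n) (a := fun t => finProdFinEquiv (t.1, t.2.1))
    (b := fun t => finProdFinEquiv (t.2.2, t.2.1)) hZ
    (fun x t => (norm_apply_le_l2_opNorm (matr (Ψ.realize x)) t.2.1 t.1).trans (hB x))
    (fun x t => (norm_apply_le_l2_opNorm (matr (Ψ.realize x)) t.2.1 t.2.2).trans (hB x)) d
  have hgram : HiddenComputable (D := D) (signParts (matEntries fun x =>
      ![matMulApprox Z d (matr (Ψ.realize x))ᵀ (matr (Ψ.realize x)), s • 1])) _ _ :=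
    hproducts.signLayer (c := N * 4) (by
      rintro ⟨k, i, j⟩
      fin_cases k
      · refine (sparseAffine_productState_matMulApprox (fun _ _ => rfl) (fun _ _ => rfl) i j).mono
          ?_
        rw [Fintype.card_fin]
      · exact (SparseAffine.const _ ((s • (1 : Matrix (Fin n) (Fin n) ℝ)) i j)).mono (by omega))
  refine hgram.mono ?_
  simp only [Fintype.card_prod, Fintype.card_fin, Nat.succ_eq_add_one]
  have hsq : n * N ≤ N * n ^ 2 := by nlinarith [Nat.mul_le_mul_left (n * N) hn]
  nlinarith [Nat.mul_le_mul_left (d + 1) hsq, Nat.zero_le (d * (N * n ^ 2))]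

theorem HiddenComputable.exists_network_matr
    (h : HiddenComputable (signParts (matEntries fun x => ![A x, X x])) ℓ M) :
    ∃ Φ : ReLUNetwork p (n * n), Φ.numLayers = ℓ + 1 ∧ Φ.numParams ≤ M + 2 * n ^ 2 ∧
      ∀ x : D, matr (Φ.realize x) = X x := by
  obtain ⟨Φ, hlayers, hparams, hrealize⟩ := h.output (c := 2)
    (g := fun x i => X x (finProdFinEquiv.symm i).2 (finProdFinEquiv.symm i).1)
    fun i => sparseAffine_signParts (matEntries fun x => ![A x, X x])
      (1, (finProdFinEquiv.symm i).2, (finProdFinEquiv.symm i).1)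
  refine ⟨Φ, hlayers, by rwa [sq], fun x => ?_⟩
  ext i j
  simp [matr, hrealize]

theorem exists_network_gramInverseApprox (hN : 0 < N) (hn : 0 < n) (Ψ : ReLUNetwork p (n * N))
    (hZ : 0 < Z) {d₁ d₂ : ℕ} {s : ℝ} (hB : ∀ x : D, ‖matr (Ψ.realize x)‖ ≤ Z)
    (hb : ∀ (x : D) k, NewtonBounded (matMulApprox Z d₂) Z
      (matMulApprox Z d₁ (matr (Ψ.realize x))ᵀ (matr (Ψ.realize x)))
      (gramInverseApprox Z d₁ d₂ s k (matr (Ψ.realize x)))) (K : ℕ) :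
    ∃ Φ : ReLUNetwork p (n * n),
      Φ.numLayers = Ψ.numLayers + (d₁ + 2) + K * (2 * (d₂ + 2)) + 1 ∧
      Φ.numParams ≤ 2 * Ψ.numParams + 64 * (d₁ + 1) * (N * n ^ 2) +
        K * (180 * (d₂ + 1) * n ^ 3) + 2 * n ^ 2 ∧
      ∀ x : D, matr (Φ.realize x) = gramInverseApprox Z d₁ d₂ s K (matr (Ψ.realize x)) :=
  ((hiddenComputable_gram hN hn Ψ hZ hB d₁ s).newtonStep_iterate hn hZ hb K).exists_network_matr

end NewtonNetworks

end ReLUNetwork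

section Accuracy

variable {α β ε : ℝ}

theorem innerAccuracy_pos (hα : 0 < α) (hβ : 0 < β) (hε : 0 < ε) : 0 < innerAccuracy α β ε := by
  unfold innerAccuracy
  positivity

/-- The bound `Z` on all factors in the approximate inversion of a Gram matrix with spectrum in
`[β ^ 2, α ^ 2]`; it dominates twice the norm of the matrix, its Gram matrix and, by
`norm_le_of_norm_one_sub_mul_le_one`, the Newton–Schulz iterates. -/
noncomputable def factorBound (α β : ℝ) : ℝ := 2 * α + 2 * α ^ 2 + 3 * (β ^ 2)⁻¹ + 4

/-- The step size of the Richardson iteration for a Gram matrix with spectrum in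
`[β ^ 2, α ^ 2]`, from which the Newton–Schulz iteration starts. -/
noncomputable def initialScale (α β : ℝ) : ℝ := (β ^ 2 + α ^ 2)⁻¹

/-- The base of the doubly exponential convergence of the Newton–Schulz iteration started at
`initialScale α β`. -/
noncomputable def newtonRate (α β : ℝ) : ℝ := 1 - 3 / 8 * (β ^ 2 / (β ^ 2 + α ^ 2))

/-- The quotient of the final residual of the Newton–Schulz iteration and the accuracy `ε`. -/
noncomputable def residualFactor (α β : ℝ) : ℝ := min (β ^ 2 / 2) (newtonRate α β)

/-- The accuracy of the Gram matrix, relative to `ε ^ 2`. -/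
noncomputable def gramTolerance (β : ℝ) : ℝ := min (β ^ 2 / 18) (β ^ 4 / 36)

/-- The accuracy of the products in the Newton–Schulz steps, relative to `ε ^ 2`. -/
noncomputable def stepTolerance (α β : ℝ) : ℝ :=
  min 1 ((1 / newtonRate α β - 1) * residualFactor α β ^ 2 / (2 + factorBound α β))

theorem factorBound_pos (hα : 0 ≤ α) : 0 < factorBound α β := by
  unfold factorBound
  positivity

theorem three_add_le_factorBound {e : ℝ} (hα : 0 ≤ α) (he : e ≤ 1) : 3 + e ≤ factorBound α β := by
  have hrest : 0 ≤ 2 * α + 2 * α ^ 2 + 3 * (β ^ 2)⁻¹ := by positivity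
  rw [factorBound]
  linarith

theorem three_mul_inv_le_factorBound (hα : 0 ≤ α) : 3 * (β ^ 2)⁻¹ ≤ factorBound α β := by
  have hrest : 0 ≤ 2 * α + 2 * α ^ 2 := by positivity
  rw [factorBound]
  linarith

theorem newtonRate_mem_Ioo (hβ : 0 < β) : newtonRate α β ∈ Set.Ioo (0 : ℝ) 1 := by
  have hratio : β ^ 2 / (β ^ 2 + α ^ 2) ≤ 1 := by
    rw [div_le_one (by positivity)]
    exact le_add_of_nonneg_right (sq_nonneg α)
  have hpos : 0 < β ^ 2 / (β ^ 2 + α ^ 2) := by positivity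
  constructor <;> rw [newtonRate] <;> linarith

theorem residualFactor_pos (hβ : 0 < β) : 0 < residualFactor α β :=
  lt_min (by positivity) (newtonRate_mem_Ioo hβ).1

theorem gramTolerance_pos (hβ : 0 < β) : 0 < gramTolerance β := by
  unfold gramTolerance
  positivity

theorem stepTolerance_pos (hα : 0 ≤ α) (hβ : 0 < β) : 0 < stepTolerance α β := by
  have hrate : 0 < 1 / newtonRate α β - 1 :=
    sub_pos.2 (one_lt_one_div (newtonRate_mem_Ioo hβ).1 (newtonRate_mem_Ioo hβ).2)
  have hfactor := residualFactor_pos (α := α) hβ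
  have hZ := factorBound_pos (β := β) hα
  unfold stepTolerance
  positivity

theorem two_add_factorBound_mul_le {e : ℝ} (hα : 0 ≤ α) (he : e ≤ stepTolerance α β * ε ^ 2) :
    (2 + factorBound α β) * e ≤ (1 / newtonRate α β - 1) * (residualFactor α β * ε) ^ 2 := by
  have hZ : 0 < 2 + factorBound α β := add_pos two_pos (factorBound_pos hα)
  calc _ ≤ (2 + factorBound α β) *
        ((1 / newtonRate α β - 1) * residualFactor α β ^ 2 / (2 + factorBound α β) * ε ^ 2) := by
        gcongr
        exact he.trans (mul_le_mul_of_nonneg_right (min_le_right _ _) (sq_nonneg ε))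
    _ = _ := by field_simp

variable {m n : Type*} [Fintype m] [Fintype n] [DecidableEq n] {B B' : Matrix m n ℝ}

theorem l2_opNorm_le_of_spectrum_gram_subset (hα : 0 ≤ α)
    (h : spectrum ℝ (Bᵀ * B) ⊆ Set.Icc (β ^ 2) (α ^ 2)) : ‖B‖ ≤ α :=
  l2_opNorm_le_of_l2_opNorm_gram_le hα <|
    l2_opNorm_le_of_spectrum_subset_Icc (isHermitian_gram B) (sq_nonneg β) (sq_nonneg α) h

theorem l2_opNorm_le_of_norm_sub_le_innerAccuracy (hα : 0 ≤ α)
    (h : spectrum ℝ (Bᵀ * B) ⊆ Set.Icc (β ^ 2) (α ^ 2)) (hB : ‖B - B'‖ ≤ innerAccuracy α β ε) :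
    ‖B'‖ ≤ α + β / 3 := by
  have hacc : innerAccuracy α β ε ≤ β / 3 := (min_le_right _ _).trans (min_le_right _ _)
  calc ‖B'‖ = ‖B - (B - B')‖ := by rw [sub_sub_cancel]
    _ ≤ ‖B‖ + ‖B - B'‖ := norm_sub_le _ _
    _ ≤ α + β / 3 := add_le_add (l2_opNorm_le_of_spectrum_gram_subset hα h) (hB.trans hacc)

theorem l2_opNorm_le_factorBound_of_norm_sub_le_innerAccuracy (hβ : 0 < β) (hαβ : β ≤ α)
    (h : spectrum ℝ (Bᵀ * B) ⊆ Set.Icc (β ^ 2) (α ^ 2)) (hB : ‖B - B'‖ ≤ innerAccuracy α β ε) :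
    ‖B'‖ ≤ factorBound α β := by
  have hα : 0 ≤ α := hβ.le.trans hαβ
  refine (l2_opNorm_le_of_norm_sub_le_innerAccuracy hα h hB).trans ?_
  have hrest : 0 ≤ 2 * α ^ 2 + 3 * (β ^ 2)⁻¹ + 4 := by positivity
  rw [factorBound]
  linarith

theorem l2_opNorm_gram_sub_gram_le_of_norm_sub_le_innerAccuracy (hβ : 0 < β) (hαβ : β ≤ α)
    (h : spectrum ℝ (Bᵀ * B) ⊆ Set.Icc (β ^ 2) (α ^ 2)) (hB : ‖B - B'‖ ≤ innerAccuracy α β ε) :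
    ‖Bᵀ * B - B'ᵀ * B'‖ ≤ 7 / 36 * β ^ 2 ∧ ‖Bᵀ * B - B'ᵀ * B'‖ ≤ 7 / 72 * (ε * β ^ 4) := by
  have hα : 0 < α := hβ.trans_le hαβ
  have hgram : ‖Bᵀ * B - B'ᵀ * B'‖ ≤ 7 / 3 * α * ‖B - B'‖ := by
    refine (l2_opNorm_gram_sub_gram_le B B').trans ?_
    gcongr
    linarith [l2_opNorm_le_of_spectrum_gram_subset hα.le h,
      l2_opNorm_le_of_norm_sub_le_innerAccuracy hα.le h hB]
  constructor
  · calc _ ≤ 7 / 3 * α * (β ^ 2 / (12 * α)) := by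
          refine hgram.trans ?_
          gcongr
          exact hB.trans ((min_le_right _ _).trans (min_le_left _ _))
      _ = 7 / 36 * β ^ 2 := by field_simp; norm_num
  · calc _ ≤ 7 / 3 * α * (ε * β ^ 4 / (24 * α)) := by
          refine hgram.trans ?_
          gcongr
          exact hB.trans ((min_le_left _ _).trans (min_le_left _ _))
      _ = 7 / 72 * (ε * β ^ 4) := by field_simp; ring

namespace ReLUNetwork

variable {d₁ d₂ : ℕ}

theorem norm_gram_sub_matMulApprox_le (hβ : 0 < β) (hαβ : β ≤ α) (hε : 0 < ε) (hε₁ : ε ≤ 1)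
    (h : spectrum ℝ (Bᵀ * B) ⊆ Set.Icc (β ^ 2) (α ^ 2)) (hB : ‖B - B'‖ ≤ innerAccuracy α β ε)
    (hd₁ : factorBound α β ^ 2 * (Fintype.card m ^ 3 / 4 ^ d₁) ≤ gramTolerance β * ε ^ 2) :
    ‖Bᵀ * B - matMulApprox (factorBound α β) d₁ B'ᵀ B'‖ ≤ β ^ 2 / 4 ∧
      ‖Bᵀ * B - matMulApprox (factorBound α β) d₁ B'ᵀ B'‖ ≤ ε * β ^ 4 / 8 := by
  classical
  have hα : 0 < α := hβ.trans_le hαβ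
  have hcard : (Fintype.card n : ℝ) ≤ Fintype.card m := by
    exact_mod_cast card_le_card_of_isUnit_transpose_mul
      (isUnit_of_spectrum_subset_Ici (sq_pos_of_pos hβ) (h.trans Set.Icc_subset_Ici_self))
  have hB' : ‖B'‖ ≤ factorBound α β :=
    l2_opNorm_le_factorBound_of_norm_sub_le_innerAccuracy hβ hαβ h hB
  have happrox : ‖matMulApprox (factorBound α β) d₁ B'ᵀ B' - B'ᵀ * B'‖ ≤
      gramTolerance β * ε ^ 2 := by
    calc _ ≤ Fintype.card n * Fintype.card n *
          (Fintype.card m * (factorBound α β ^ 2 / 4 ^ d₁)) :=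
        norm_matMulApprox_sub_mul_le (factorBound_pos hα.le) d₁
          ((l2_opNorm_transpose B').trans_le hB') hB'
      _ ≤ Fintype.card m * Fintype.card m *
          (Fintype.card m * (factorBound α β ^ 2 / 4 ^ d₁)) := by gcongr
      _ = factorBound α β ^ 2 * (Fintype.card m ^ 3 / 4 ^ d₁) := by ring
      _ ≤ _ := hd₁
  have htriangle := norm_sub_le_norm_sub_add_norm_sub (Bᵀ * B) (B'ᵀ * B')
    (matMulApprox (factorBound α β) d₁ B'ᵀ B')
  rw [norm_sub_rev (B'ᵀ * B')] at htriangle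
  obtain ⟨hgram, hgram'⟩ :=
    l2_opNorm_gram_sub_gram_le_of_norm_sub_le_innerAccuracy hβ hαβ h hB
  have htol : gramTolerance β * ε ^ 2 ≤ β ^ 2 / 18 * 1 := by
    gcongr
    · exact min_le_left _ _
    · exact pow_le_one₀ hε.le hε₁
  have htol' : gramTolerance β * ε ^ 2 ≤ β ^ 4 / 36 * ε := by
    gcongr
    · exact min_le_right _ _
    · exact pow_le_of_le_one hε.le hε₁ two_ne_zero
  constructor <;> linarith

theorem norm_one_sub_mul_initialScale_le {A A' : Matrix n n ℝ} (hβ : 0 < β) (hA : A.IsHermitian)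
    (h : spectrum ℝ A ⊆ Set.Icc (β ^ 2) (α ^ 2)) (hA' : ‖A - A'‖ ≤ β ^ 2 / 4) :
    ‖1 - A' * initialScale α β • (1 : Matrix n n ℝ)‖ ≤ newtonRate α β ^ 2 := by
  have hs : 0 < initialScale α β := by unfold initialScale; positivity
  have hsplit : 1 - A' * initialScale α β • (1 : Matrix n n ℝ) =
      (1 - initialScale α β • A) + initialScale α β • (A - A') := by
    rw [mul_smul_comm, mul_one, smul_sub]
    abel
  have hstart := l2_opNorm_one_sub_smul_le_of_spectrum_subset_Icc hA (sq_pos_of_pos hβ)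
    (sq_nonneg α) h
  have hpert : ‖initialScale α β • (A - A')‖ ≤ initialScale α β * (β ^ 2 / 4) := by
    rw [norm_smul, Real.norm_of_nonneg hs.le]
    gcongr
  have hratio : initialScale α β * (β ^ 2 / 4) = β ^ 2 / (β ^ 2 + α ^ 2) / 4 := by
    rw [initialScale]
    ring
  calc _ ≤ ‖1 - initialScale α β • A‖ + ‖initialScale α β • (A - A')‖ := by
        rw [hsplit]
        exact norm_add_le _ _
    _ ≤ newtonRate α β ^ 2 := by
        rw [newtonRate]
        rw [← initialScale] at hstart
        nlinarith [sq_nonneg (β ^ 2 / (β ^ 2 + α ^ 2))]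

theorem norm_le_factorBound_of_norm_sub_le {A A' : Matrix n n ℝ} (hβ : 0 < β) (hαβ : β ≤ α)
    (hA : A.IsHermitian) (h : spectrum ℝ A ⊆ Set.Icc (β ^ 2) (α ^ 2))
    (hA' : ‖A - A'‖ ≤ β ^ 2 / 4) : ‖A'‖ ≤ factorBound α β := by
  have hnorm : ‖A‖ ≤ α ^ 2 := l2_opNorm_le_of_spectrum_subset_Icc hA (sq_nonneg β) (sq_nonneg α) h
  have hβα : β ^ 2 ≤ α ^ 2 := pow_le_pow_left₀ hβ.le hαβ 2
  have hrest : 0 ≤ 2 * α + 3 * (β ^ 2)⁻¹ := add_nonneg (by linarith) (by positivity)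
  calc ‖A'‖ = ‖A - (A - A')‖ := by rw [sub_sub_cancel]
    _ ≤ ‖A‖ + ‖A - A'‖ := norm_sub_le _ _
    _ ≤ factorBound α β := by rw [factorBound]; linarith [sq_nonneg α]

theorem newtonBounded_and_norm_inv_sub_gramInverseApprox_le [Nonempty n] (hβ : 0 < β)
    (hαβ : β ≤ α) (hε : 0 < ε) (hε₁ : ε ≤ 1)
    (h : spectrum ℝ (Bᵀ * B) ⊆ Set.Icc (β ^ 2) (α ^ 2)) (hB : ‖B - B'‖ ≤ innerAccuracy α β ε)
    (hd₁ : factorBound α β ^ 2 * (Fintype.card m ^ 3 / 4 ^ d₁) ≤ gramTolerance β * ε ^ 2)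
    (hd₂ : factorBound α β ^ 2 * (Fintype.card n ^ 3 / 4 ^ d₂) ≤ stepTolerance α β * ε ^ 2)
    (k : ℕ) :
    NewtonBounded (matMulApprox (factorBound α β) d₂) (factorBound α β)
        (matMulApprox (factorBound α β) d₁ B'ᵀ B')
        (gramInverseApprox (factorBound α β) d₁ d₂ (initialScale α β) k B') ∧
      ‖(Bᵀ * B)⁻¹ - gramInverseApprox (factorBound α β) d₁ d₂ (initialScale α β) k B'‖ ≤
        (β ^ 2)⁻¹ * (residualBound (newtonRate α β) (residualFactor α β * ε) k +
          ε * β ^ 4 / 8 * (3 * (β ^ 2)⁻¹)) := by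
  have hα : 0 < α := hβ.trans_le hαβ
  obtain ⟨hA', hA'ε⟩ := norm_gram_sub_matMulApprox_le hβ hαβ hε hε₁ h hB hd₁
  set A' := matMulApprox (factorBound α β) d₁ B'ᵀ B'
  set e := factorBound α β ^ 2 * (Fintype.card n ^ 3 / 4 ^ d₂ : ℝ)
  have hge : spectrum ℝ (Bᵀ * B) ⊆ Set.Ici (β ^ 2) := h.trans Set.Icc_subset_Ici_self
  have hinv : (Bᵀ * B)⁻¹ * (Bᵀ * B) = 1 :=
    Matrix.nonsing_inv_mul _ <| (Matrix.isUnit_iff_isUnit_det _).1 <|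
      isUnit_of_spectrum_subset_Ici (sq_pos_of_pos hβ) hge
  have hκ : ‖(Bᵀ * B)⁻¹‖ ≤ (β ^ 2)⁻¹ :=
    l2_opNorm_inv_le_of_spectrum_subset_Ici (isHermitian_gram B) (sq_pos_of_pos hβ) hge
  have hA'Z : ‖A'‖ ≤ factorBound α β :=
    norm_le_factorBound_of_norm_sub_le hβ hαβ (isHermitian_gram B) h hA'
  have hκA' : (β ^ 2)⁻¹ * ‖Bᵀ * B - A'‖ ≤ 1 / 4 := by
    rw [inv_mul_le_iff₀ (sq_pos_of_pos hβ)]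
    linarith
  have he₁ : e ≤ 1 :=
    hd₂.trans (mul_le_one₀ (min_le_left _ _) (sq_nonneg ε) (pow_le_one₀ hε.le hε₁))
  obtain ⟨hp, hp₁⟩ := newtonRate_mem_Ioo (α := α) hβ
  have hθ := residualFactor_pos (α := α) hβ
  have hθp : residualFactor α β * ε ≤ newtonRate α β :=
    (mul_le_of_le_one_right hθ.le hε₁).trans (min_le_right _ _)
  obtain ⟨hbounded, herror⟩ := newtonBounded_iterate_and_norm_sub_iterate_le
    (isApproxMul_matMulApprox (factorBound_pos hα.le) d₂)
    (three_add_le_factorBound hα.le he₁) (three_mul_inv_le_factorBound hα.le) hA'Z hinv hκ hκA'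
    hp hp₁.le (by positivity) hθp (two_add_factorBound_mul_le hα.le hd₂)
    (norm_one_sub_mul_initialScale_le hβ (isHermitian_gram B) h hA') k
  refine ⟨hbounded, herror.trans ?_⟩
  gcongr

theorem norm_inv_sub_gramInverseApprox_le [Nonempty n] (hβ : 0 < β) (hαβ : β ≤ α) (hε : 0 < ε)
    (hε₁ : ε ≤ 1) (h : spectrum ℝ (Bᵀ * B) ⊆ Set.Icc (β ^ 2) (α ^ 2))
    (hB : ‖B - B'‖ ≤ innerAccuracy α β ε)
    (hd₁ : factorBound α β ^ 2 * (Fintype.card m ^ 3 / 4 ^ d₁) ≤ gramTolerance β * ε ^ 2)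
    (hd₂ : factorBound α β ^ 2 * (Fintype.card n ^ 3 / 4 ^ d₂) ≤ stepTolerance α β * ε ^ 2)
    {K : ℕ} (hK : newtonRate α β ^ (2 ^ K + 1) ≤ residualFactor α β * ε) :
    ‖(Bᵀ * B)⁻¹ - gramInverseApprox (factorBound α β) d₁ d₂ (initialScale α β) K B'‖ ≤ ε := by
  have hres : residualBound (newtonRate α β) (residualFactor α β * ε) K ≤ β ^ 2 / 2 * ε :=
    (max_le le_rfl hK).trans (mul_le_mul_of_nonneg_right (min_le_left _ _) hε.le)
  calc _ ≤ (β ^ 2)⁻¹ * (residualBound (newtonRate α β) (residualFactor α β * ε) K +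
        ε * β ^ 4 / 8 * (3 * (β ^ 2)⁻¹)) :=
        (newtonBounded_and_norm_inv_sub_gramInverseApprox_le hβ hαβ hε hε₁ h hB hd₁ hd₂ K).2
    _ ≤ (β ^ 2)⁻¹ * (β ^ 2 / 2 * ε + ε * β ^ 4 / 8 * (3 * (β ^ 2)⁻¹)) := by gcongr
    _ = 7 / 8 * ε := by field_simp; ring
    _ ≤ ε := by linarith

theorem exists_network_gram_inverse {p N n K : ℕ} {D : Set (Fin p → ℝ)}
    {B : (Fin p → ℝ) → Matrix (Fin N) (Fin n) ℝ} (hN : 0 < N) (hn : 0 < n) (hβ : 0 < β)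
    (hαβ : β ≤ α) (hε : 0 < ε) (hε₁ : ε ≤ 1) (hspec : SpectrumAssumption α β D B)
    (Ψ : ReLUNetwork p (n * N))
    (hΨ : ∀ μ ∈ D, ‖B μ - matr (Ψ.realize μ)‖ ≤ innerAccuracy α β ε)
    (hd₁ : factorBound α β ^ 2 * (N ^ 3 / 4 ^ d₁) ≤ gramTolerance β * ε ^ 2)
    (hd₂ : factorBound α β ^ 2 * (n ^ 3 / 4 ^ d₂) ≤ stepTolerance α β * ε ^ 2)
    (hK : newtonRate α β ^ (2 ^ K + 1) ≤ residualFactor α β * ε) :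
    ∃ Φ : ReLUNetwork p (n * n),
      (∀ μ ∈ D, ‖((B μ)ᵀ * B μ)⁻¹ - matr (Φ.realize μ)‖ ≤ ε) ∧
      Φ.numLayers = Ψ.numLayers + (d₁ + 2) + K * (2 * (d₂ + 2)) + 1 ∧
      Φ.numParams ≤ 2 * Ψ.numParams + 64 * (d₁ + 1) * (N * n ^ 2) +
        K * (180 * (d₂ + 1) * n ^ 3) + 2 * n ^ 2 := by
  have := Fin.pos_iff_nonempty.1 hn
  rw [← Fintype.card_fin N] at hd₁
  rw [← Fintype.card_fin n] at hd₂
  obtain ⟨Φ, hlayers, hparams, hmatr⟩ := exists_network_gramInverseApprox hN hn Ψ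
    (factorBound_pos (hβ.le.trans hαβ))
    (fun x : D => l2_opNorm_le_factorBound_of_norm_sub_le_innerAccuracy hβ hαβ
      (hspec x x.2) (hΨ x x.2))
    (fun x k => (newtonBounded_and_norm_inv_sub_gramInverseApprox_le hβ hαβ hε hε₁
      (hspec x x.2) (hΨ x x.2) hd₁ hd₂ k).1) K
  refine ⟨Φ, fun μ hμ => ?_, hlayers, hparams⟩
  rw [hmatr ⟨μ, hμ⟩]
  exact norm_inv_sub_gramInverseApprox_le hβ hαβ hε hε₁ (hspec μ hμ) (hΨ μ hμ) hd₁ hd₂ hK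

end ReLUNetwork

end Accuracy

section Size

variable {n N l ll ln lN d₁ d₂ K C₁ C₂ C₃ : ℝ}

theorem steps_mul_depth_le (hK₀ : 0 ≤ K) (hl : 0 ≤ l + ln) (hC₂ : 0 ≤ C₂) (hK : K ≤ C₃ * ll)
    (hd₂ : d₂ + 2 ≤ C₂ * (l + ln)) : K * (d₂ + 2) ≤ C₂ * C₃ * (ll * (l + ln)) := by
  calc K * (d₂ + 2) ≤ K * (C₂ * (l + ln)) := mul_le_mul_of_nonneg_left hd₂ hK₀
    _ ≤ C₃ * ll * (C₂ * (l + ln)) := by gcongr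
    _ = C₂ * C₃ * (ll * (l + ln)) := by ring

theorem numLayers_bound (hl : 1 ≤ l) (hll : 1 ≤ ll) (hln : 0 ≤ ln) (hlN : 0 ≤ lN) (hC₁ : 0 ≤ C₁)
    (hC₂ : 0 ≤ C₂) (hC₃ : 0 ≤ C₃) (hK₀ : 0 ≤ K) (hK : K ≤ C₃ * ll) (hd₁ : d₁ + 2 ≤ C₁ * (l + lN))
    (hd₂ : d₂ + 2 ≤ C₂ * (l + ln)) :
    d₁ + 2 + K * (2 * (d₂ + 2)) + 1 ≤
      (C₁ + 2 * (C₂ * C₃) + 1) * ll * (l + ln) + (C₁ + 2 * (C₂ * C₃) + 1) * lN := by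
  have hl_le : l ≤ ll * (l + ln) := by nlinarith
  calc _ = d₁ + 2 + 2 * (K * (d₂ + 2)) + 1 := by ring
    _ ≤ C₁ * (l + lN) + 2 * (C₂ * C₃ * (ll * (l + ln))) + 1 := by
      linarith [steps_mul_depth_le hK₀ (by linarith : 0 ≤ l + ln) hC₂ hK hd₂]
    _ ≤ C₁ * (ll * (l + ln) + lN) + 2 * (C₂ * C₃ * (ll * (l + ln))) + ll * (l + ln) +
        (2 * (C₂ * C₃) + 1) * lN := by
      have hrest : 0 ≤ (2 * (C₂ * C₃) + 1) * lN := by positivity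
      have hterm : C₁ * (l + lN) ≤ C₁ * (ll * (l + ln) + lN) := by gcongr
      linarith
    _ = _ := by ring

theorem numParams_bound (hn : 1 ≤ n) (hN : 0 ≤ N) (hl : 1 ≤ l) (hll : 0 ≤ ll) (hll_le : ll ≤ l)
    (hln : 0 ≤ ln) (hlN : 0 ≤ lN) (hC₁ : 0 ≤ C₁) (hC₂ : 0 ≤ C₂) (hC₃ : 0 ≤ C₃) (hK₀ : 0 ≤ K)
    (hK : K ≤ C₃ * ll) (hd₁ : d₁ + 2 ≤ C₁ * (l + lN)) (hd₂ : d₂ + 2 ≤ C₂ * (l + ln)) :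
    64 * (d₁ + 1) * (N * n ^ 2) + K * (180 * (d₂ + 1) * n ^ 3) + 2 * n ^ 2 ≤
      (64 * C₁ + 180 * (C₂ * C₃) + 2) * n ^ 2 * l * (ll + n) * (l + ln) +
        (64 * C₁ + 180 * (C₂ * C₃) + 2) * N * n ^ 2 * (l + lN) := by
  set T := n ^ 2 * l * (ll + n) * (l + ln) with hT
  set U := N * n ^ 2 * (l + lN) with hU
  have hT₀ : 0 ≤ T := by positivity
  have hU₀ : 0 ≤ U := by positivity
  have hgram : 64 * (d₁ + 1) * (N * n ^ 2) ≤ 64 * C₁ * U := by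
    calc _ ≤ 64 * (C₁ * (l + lN)) * (N * n ^ 2) := by gcongr; linarith
      _ = 64 * C₁ * U := by ring
  have hsteps : K * (180 * (d₂ + 1) * n ^ 3) ≤ 180 * (C₂ * C₃) * T := by
    calc _ = 180 * n ^ 3 * (K * (d₂ + 1)) := by ring
      _ ≤ 180 * n ^ 3 * (K * (d₂ + 2)) := by gcongr; norm_num
      _ ≤ 180 * n ^ 3 * (C₂ * C₃ * (ll * (l + ln))) :=
        mul_le_mul_of_nonneg_left (steps_mul_depth_le hK₀ (by linarith) hC₂ hK hd₂) (by positivity)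
      _ = 180 * (C₂ * C₃) * (n ^ 2 * ll * (0 + n) * (l + ln)) := by ring
      _ ≤ 180 * (C₂ * C₃) * T := by rw [hT]; gcongr
  have hout : n ^ 2 ≤ T := by
    calc n ^ 2 = n ^ 2 * 1 * (0 + 1) * (1 + 0) := by ring
      _ ≤ T := by rw [hT]; gcongr
  calc _ ≤ 64 * C₁ * U + 180 * (C₂ * C₃) * T + 2 * T := by linarith
    _ ≤ 64 * C₁ * U + 180 * (C₂ * C₃) * T + 2 * T + (64 * C₁ * T + (180 * (C₂ * C₃) + 2) * U) :=
      le_add_of_nonneg_right (add_nonneg (mul_nonneg (by positivity) hT₀)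
        (mul_nonneg (by positivity) hU₀))
    _ = _ := by rw [hT, hU]; ring

end Size

theorem mainTheorem3_general {α β : ℝ} (hβ : 0 < β) (hαβ : β ≤ α) :
    ∃ C_L C_M : ℝ, 0 < C_L ∧ 0 < C_M ∧
      ∀ {p N n : ℕ}, 0 < N → 0 < n → ∀ {D : Set (Fin p → ℝ)}
        {B : (Fin p → ℝ) → Matrix (Fin N) (Fin n) ℝ}, SpectrumAssumption α β D B →
        ∀ {ε : ℝ}, ε ∈ Set.Ioo (0 : ℝ) (1 / 4) → ∀ Ψ : ReLUNetwork p (n * N),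
        (∀ μ ∈ D, ‖B μ - matr (Ψ.realize μ)‖ ≤ innerAccuracy α β ε) →
        ∃ Φ : ReLUNetwork p (n * n),
          (∀ μ ∈ D, ‖((B μ)ᵀ * B μ)⁻¹ - matr (Φ.realize μ)‖ ≤ ε) ∧
          (Φ.numLayers : ℝ) ≤
            C_L * Real.logb 2 (Real.logb 2 (1 / ε)) * (Real.logb 2 (1 / ε) + Real.logb 2 n)
              + C_L * Real.logb 2 N + Ψ.numLayers ∧
          (Φ.numParams : ℝ) ≤
            C_M * (n : ℝ) ^ 2 * Real.logb 2 (1 / ε) * (Real.logb 2 (Real.logb 2 (1 / ε)) + n)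
                * (Real.logb 2 (1 / ε) + Real.logb 2 n)
              + C_M * N * (n : ℝ) ^ 2 * (Real.logb 2 (1 / ε) + Real.logb 2 N)
              + 2 * Ψ.numParams := by
  have hα : 0 ≤ α := hβ.le.trans hαβ
  have hZ : 0 < factorBound α β := factorBound_pos hα
  obtain ⟨C₁, hC₁, hdepth₁⟩ := exists_depth_mul_cube_div_le (sq_pos_of_pos hZ)
    (gramTolerance_pos hβ)
  obtain ⟨C₂, hC₂, hdepth₂⟩ := exists_depth_mul_cube_div_le (sq_pos_of_pos hZ)
    (stepTolerance_pos hα hβ)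
  obtain ⟨C₃, hC₃, hsteps⟩ := exists_steps_residual_le (newtonRate_mem_Ioo (α := α) hβ).1.le
    (newtonRate_mem_Ioo hβ).2 (residualFactor_pos (α := α) hβ)
  refine ⟨C₁ + 2 * (C₂ * C₃) + 1, 64 * C₁ + 180 * (C₂ * C₃) + 2, by positivity, by positivity,
    fun {p N n} hN hn D B hspec ε hε Ψ hΨ => ?_⟩
  obtain ⟨d₁, hd₁, hd₁'⟩ := hdepth₁ ε hε N hN
  obtain ⟨d₂, hd₂, hd₂'⟩ := hdepth₂ ε hε n hn
  obtain ⟨K, hK, hK'⟩ := hsteps ε hε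
  obtain ⟨Φ, happrox, hlayers, hparams⟩ := ReLUNetwork.exists_network_gram_inverse hN hn hβ hαβ
    hε.1 (hε.2.le.trans (by norm_num)) hspec Ψ hΨ hd₁' hd₂' hK'
  have hl := two_le_logb_one_div hε
  have hll := one_le_logb_logb_one_div hε
  refine ⟨Φ, happrox, ?_, ?_⟩
  · have hbound := numLayers_bound (one_le_two.trans hl) hll (logb_two_natCast_nonneg n)
      (logb_two_natCast_nonneg N) hC₁.le hC₂.le hC₃.le K.cast_nonneg hK hd₁ hd₂
    rw [hlayers]
    push_cast
    linarith
  · have hbound := numParams_bound (Nat.one_le_cast.2 hn) N.cast_nonneg (one_le_two.trans hl)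
      (zero_le_one.trans hll) (logb_two_le_self (one_le_two.trans hl)) (logb_two_natCast_nonneg n)
      (logb_two_natCast_nonneg N) hC₁.le hC₂.le hC₃.le K.cast_nonneg hK hd₁ hd₂
    have hparams' : (Φ.numParams : ℝ) ≤ 2 * Ψ.numParams + 64 * (d₁ + 1) * (N * n ^ 2) +
        K * (180 * (d₂ + 1) * n ^ 3) + 2 * n ^ 2 := by exact_mod_cast hparams
    linarith

theorem mainTheorem3 (α β : ℝ) (hβ : 0 < β) (hαβ : β < α) :
    ∃ C_L C_M : ℝ, 0 < C_L ∧ 0 < C_M ∧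
      ∀ (p N NI n : ℕ) (_hN : 0 < N) (_hn : 0 < n) (_hNI : NI ≤ N)
        (D : Set (Fin p → ℝ))
        (L : (Fin p → ℝ) → Matrix (Fin NI) (Fin N) ℝ)
        (V : Matrix (Fin N) (Fin n) ℝ)
        (_hspec : SpectrumAssumption α β D (reducedMatrix L V))
        (ΦB : ℝ → ReLUNetwork p (n * N))
        (_happrox : ReLUApproximates D (reducedMatrix L V) ΦB)
        (ε : ℝ) (_hε : ε ∈ Set.Ioo (0 : ℝ) (1 / 4)),
        ∃ Φ : ReLUNetwork p (n * n),
          (∀ μ ∈ D, ‖((reducedMatrix L V μ)ᵀ * reducedMatrix L V μ)⁻¹ - matr (Φ.realize μ)‖ ≤ ε) ∧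
          (Φ.numLayers : ℝ) ≤
            C_L * Real.logb 2 (Real.logb 2 (1 / ε)) * (Real.logb 2 (1 / ε) + Real.logb 2 n)
              + C_L * Real.logb 2 N
              + (ΦB (innerAccuracy α β ε)).numLayers ∧
          (Φ.numParams : ℝ) ≤
            C_M * (n : ℝ) ^ 2 * Real.logb 2 (1 / ε) * (Real.logb 2 (Real.logb 2 (1 / ε)) + n)
                * (Real.logb 2 (1 / ε) + Real.logb 2 n)
              + C_M * N * (n : ℝ) ^ 2 * (Real.logb 2 (1 / ε) + Real.logb 2 N)
              + 8 * (ΦB (innerAccuracy α β ε)).numParams := by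
  obtain ⟨C_L, C_M, hC_L, hC_M, hnetwork⟩ := mainTheorem3_general hβ hαβ.le
  refine ⟨C_L, C_M, hC_L, hC_M, fun p N NI n hN hn _ D L V hspec ΦB happrox ε hε => ?_⟩
  obtain ⟨Φ, happroxΦ, hlayers, hparams⟩ := hnetwork hN hn hspec hε (ΦB (innerAccuracy α β ε))
    (happrox _ (innerAccuracy_pos (hβ.trans hαβ) hβ hε.1))
  exact ⟨Φ, happroxΦ, hlayers, hparams.trans (by gcongr; norm_num)⟩
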